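/- Let $d\ge 1$ be an integer and consider a deck of $2^d$ cards whose positions are identified with $\{0,1\}^d$. For $x\in\{0,1\}^d$ write $x=(L(x),R(x))$, where $L(x)\in\{0,1\}^{d-1}$ consists of the leftmost $d-1$ bits and $R(x)\in\{0,1\}$ is the rightmost bit. Let $\{Z(l,t): l\in\{0,1\}^{d-1},\ t\in\{0,1,2,\dots\}\}$ be i.i.d. Bernoulli$(1/2)$ random variables. The reverse Thorp shuffle is the process $(X_t)_{t\ge 0}$ of random permutations of $\{0,1\}^d$ with $X_0=\mathrm{id}$ and $X_{t+1}=\nu_t\circ X_t$, where $\nu_t$ is the permutation $(L,R)\mapsto (R\oplus Z(L,t),\,L)$. For a random variable $Y$ with values in a finite set $V$, let $$\mathrm{ENT}(Y)=\sum_{v\in V}\mathbf P(Y=v)\,\log\bigl(|V|\,\mathbf P(Y=v)\bigr),\qquad 0\log 0=0,$$ be its relative entropy with respect to the uniform distribution on $V$; for a random permutation, $V$ is the set of all $(2^d)!$ permutations of $\{0,1\}^d$. There is a universal constant $c>0$ such that for every $d\ge 1$ and every random permutation $\mu$ of $\{0,1\}^d$ that is independent of the process $\{X_t\}$, $$\mathrm{ENT}(X_d\circ\mu)\le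 (1-c/d)\,\mathrm{ENT}(\mu).$$ -/

import Mathlib

open MeasureTheory ProbabilityTheory

/-- The hypercube `{0,1}^k`. A word `x` is read from left to right: `x 0` is its leftmost bit. -/
abbrev Cube (k : ℕ) : Type := Fin k → Bool

/-- Permutations carry the discrete sigma-algebra (they are only used on finite sets). -/
instance permMeasurableSpace (α : Type) : MeasurableSpace (Equiv.Perm α) := ⊤

/-- One round of the reverse Thorp shuffle on positions `{0,1}^(m+1)`, with coins `z`:
writing `x = (L, R)` with `L = Fin.init x` the leftmost `m` bits and `R = x (Fin.last m)` the
rightmost bit, it sends `(L, R)` to `(R ⊕ z L, L)`. -/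
def rtStep {m : ℕ} (z : Cube m → Bool) : Equiv.Perm (Cube (m + 1)) where
  toFun x := Fin.cons (xor (x (Fin.last m)) (z (Fin.init x))) (Fin.init x)
  invFun y := Fin.snoc (Fin.tail y) (xor (y 0) (z (Fin.tail y)))
  left_inv x := by simp
  right_inv y := by simp

/-- The reverse Thorp shuffle started from the identity and driven by the coins `z t l`
(`t` is the time, `l` the leftmost bits): `X 0 = id` and `X (t + 1) = ν ∘ X t`, where `ν` is the
round with the coins of time `t`. -/
def reverseThorp {m : ℕ} (z : ℕ → Cube m → Bool) : ℕ → Equiv.Perm (Cube (m + 1))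
  | 0 => 1
  | t + 1 => rtStep (z t) * reverseThorp z t

/-- The reverse Thorp process `ω ↦ (X_0 ω, X_1 ω, …)` built from random bits `Z t l`. -/
def reverseThorpProcess {Ω : Type*} {m : ℕ} (Z : ℕ → Cube m → Ω → Bool) (ω : Ω) :
    ℕ → Equiv.Perm (Cube (m + 1)) :=
  reverseThorp fun t l => Z t l ω

/-- The `Z t l` are independent, identically distributed Bernoulli(1/2) random bits. -/
structure IsFairCoins {Ω : Type*} [MeasurableSpace Ω] (P : Measure Ω) {m : ℕ}
    (Z : ℕ → Cube m → Ω → Bool) : Prop where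
  measurable : ∀ t l, Measurable (Z t l)
  fair : ∀ t l, P (Z t l ⁻¹' {true}) = 1 / 2
  indep : iIndepFun (fun i : ℕ × Cube m => Z i.1 i.2) P

/-- Relative entropy (with respect to the uniform distribution) of a family of probabilities,
`∑ i, p i * log (|V| * p i)`, where `0 * log 0 = 0`. -/
noncomputable def relEntropy {V : Type*} [Fintype V] (p : V → ℝ) : ℝ :=
  ∑ i, p i * Real.log (Fintype.card V * p i)

/-- `ENT(Y)`: the relative entropy of the distribution of a random variable `Y`. -/
noncomputable def ENT {Ω V : Type*} [MeasurableSpace Ω] [Fintype V] (P : Measure Ω)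
    (Y : Ω → V) : ℝ :=
  relEntropy fun v => P.real (Y ⁻¹' {v})

/-! Over `d` rounds the first bit of a position travels to the right end, where the last round xors
it with a coin. Until then the two halves of the cube cut along that bit are shuffled independently
by rounds of one dimension less. So `d` rounds act as the network `butterfly`: mix each half
recursively, then exchange opposite positions by fair coins (`iterate_thorpStep`).

The entropy drop is proved by induction on the dimension (`butterfly_entropy_drop`), with the same
fraction `κ = 1 / (72 L)` at every level, where `log (2 ^ d) ≤ L`. By the chain rule the entropy of
the deck is at most the sum of three terms: the entropy of the right half given the left; that of
the left half given the right, once the right has been mixed; and that of the set of labels in the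
right half (`two_stage_chain_rule`, `sum_conditional_log_nonneg`). The induction hypothesis removes
a fraction `κ` of the first two, the final exchanges a fraction `κ` of the third
(`coinSwap_entropy_drop`). As the terms add up, no loss accumulates over the levels, and `1 / d`
enters only through `L`.

For the exchanges, mixing the left half makes each left label, given the right half, uniform on the
labels that the right half misses. Reveal the right half in a uniformly random order, and let `t` be
the density of its `k`-th label given the earlier ones, relative to the uniform law on the remaining
labels. The variational formula for the entropy lost is tested with `2 t / (1 + t)`, the optimal
choice if the incoming label were uniform on the remaining ones (`sum_right_test_le`,
`sum_test_ge`). The resulting divergence to a midpoint controls `t log t` up to a factor of order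
`L`, because `t ≤ 2 ^ d` (`mul_log_le_midpoint`). Since the order is random, the terms `log t` add
up to the entropy of the set of labels. -/

/-! ### Scalar entropy inequalities and the variational lower bound. -/

/-- The unnormalised negative Shannon entropy `∑ p log p`. -/
noncomputable def sumMulLog {α : Type*} [Fintype α] (p : α → ℝ) : ℝ :=
  ∑ a, p a * Real.log (p a)

theorem sumMulLog_comp_equiv {α β : Type*} [Fintype α] [Fintype β] (e : α ≃ β) (p : β → ℝ) :
    sumMulLog (fun a => p (e a)) = sumMulLog p :=
  e.sum_comp fun b => p b * Real.log (p b)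

/-- This is `1 - 1 / x ≤ log x` at `x = √v`, multiplied by `2 v`. -/
theorem sq_sqrt_sub_one_le {v : ℝ} (hv : 0 ≤ v) :
    (√v - 1) ^ 2 ≤ v * Real.log v - v + 1 := by
  rcases hv.eq_or_lt with rfl | hv
  · simp
  have hs : 0 < √v := Real.sqrt_pos.2 hv
  have h1 : 1 - (√v)⁻¹ ≤ Real.log (√v) := Real.one_sub_inv_le_log_of_pos hs
  have h2 : Real.log v = 2 * Real.log (√v) := by
    rw [Real.log_sqrt hv.le]; ring
  have h3 : √v * √v = v := Real.mul_self_sqrt hv.le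
  have h4 : v * (1 - (√v)⁻¹) ≤ v * Real.log (√v) := mul_le_mul_of_nonneg_left h1 hv.le
  have h5 : v * (√v)⁻¹ = √v := by
    field_simp; nlinarith
  nlinarith

/-- Factor `v - 1 = (√v - 1) (√v + 1)`; the constant comes from `(√2 + 1) ^ 2 < 6`. -/
theorem sq_sub_one_le_six_mul {v : ℝ} (hv : 0 ≤ v) (hv2 : v ≤ 2) :
    (v - 1) ^ 2 ≤ 6 * (v * Real.log v - v + 1) := by
  have h := sq_sqrt_sub_one_le hv
  have hs : 0 ≤ √v := Real.sqrt_nonneg v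
  have h3 : √v * √v = v := Real.mul_self_sqrt hv
  have h4 : √v ≤ 1.42 := Real.sqrt_le_iff.2 ⟨by norm_num, by norm_num; linarith⟩
  have h5 : (√v + 1) ^ 2 ≤ 6 := by nlinarith
  have h6 : (v - 1) ^ 2 = (√v + 1) ^ 2 * (√v - 1) ^ 2 := by
    rw [← mul_pow]; congr 1; nlinarith
  rw [h6]
  calc _ ≤ 6 * (√v - 1) ^ 2 := mul_le_mul_of_nonneg_right h5 (sq_nonneg _)
    _ ≤ _ := by linarith

/-- Comparison of the divergence to the midpoint with the relative entropy, for densities `t` with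
`log t ≤ L`. -/
theorem mul_log_le_midpoint {t L : ℝ} (ht : 0 ≤ t) (hL : 1 / 2 ≤ L) (hlog : Real.log t ≤ L) :
    t * Real.log t - t + 1 ≤ 72 * L * (t * Real.log (2 * t / (1 + t)) + (1 - t) / 2) := by
  have h1t : 0 < 1 + t := by linarith
  set v : ℝ := 2 * t / (1 + t) with hv
  have hv0 : 0 ≤ v := by positivity
  have hv2 : v ≤ 2 := by rw [hv, div_le_iff₀ h1t]; linarith
  have hA := sq_sub_one_le_six_mul hv0 hv2
  have e1 : t = v * (1 + t) / 2 := by rw [hv]; field_simp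
  have e2 : t * Real.log v + (1 - t) / 2 = (1 + t) / 2 * (v * Real.log v - v + 1) := by
    have : v * (1 + t) = 2 * t := by rw [hv]; field_simp
    linear_combination (-(Real.log v) / 2 + 1 / 2) * this
  have e3 : (v - 1) ^ 2 * (1 + t) ^ 2 = (t - 1) ^ 2 := by
    rw [hv]; field_simp; ring
  rw [e2]
  have hB : (t - 1) ^ 2 ≤ 12 * (1 + t) * ((1 + t) / 2 * (v * Real.log v - v + 1)) := by
    rw [← e3]
    nlinarith [mul_le_mul_of_nonneg_right hA (sq_nonneg (1 + t))]
  set G := (1 + t) / 2 * (v * Real.log v - v + 1)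
  have hG : 0 ≤ G := by
    by_contra hneg
    have := mul_neg_of_pos_of_neg (show 0 < 12 * (1 + t) by positivity) (not_le.1 hneg)
    nlinarith [sq_nonneg (t - 1)]
  -- Below 2 the left side is at most `(t - 1) ^ 2 ≤ 36 G`, and `2 L ≥ 1`. Above 2 it is at most `t
  -- L`, and `t ≤ 72 G`; the bound `hE` is an equality at `t = 2`.
  rcases le_total t 2 with h2 | h2
  · have hC : t * Real.log t - t + 1 ≤ (t - 1) ^ 2 := by
      rcases ht.eq_or_lt with rfl | htp
      · simp
      nlinarith [mul_le_mul_of_nonneg_left (Real.log_le_sub_one_of_pos htp) ht]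
    nlinarith [mul_nonneg (sub_nonneg.2 h2) hG, mul_nonneg (sub_nonneg.2 hL) hG]
  · have hD : t * Real.log t - t + 1 ≤ t * L := by
      nlinarith [mul_le_mul_of_nonneg_left hlog ht]
    have hE : t / 6 * (1 + t) ≤ (t - 1) ^ 2 := by nlinarith
    have hF : t / 6 ≤ 12 * G := by
      have : t / 6 * (1 + t) ≤ 12 * G * (1 + t) := by linarith
      exact le_of_mul_le_mul_right this h1t
    nlinarith [mul_le_mul_of_nonneg_left hF (show 0 ≤ L by linarith)]

/-- Pointwise Gibbs inequality. -/
theorem mul_log_sub_log_ge {p m g : ℝ} (hp : 0 ≤ p) (hm : 0 ≤ m) (hg : 0 ≤ g)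
    (hpm : 0 < p → 0 < m) (hpg : 0 < p → 0 < g) :
    p * Real.log g + p - m * g ≤ p * Real.log p - p * Real.log m := by
  rcases hp.eq_or_lt with rfl | hp
  · simpa using mul_nonneg hm hg
  have hm := hpm hp
  have hg := hpg hp
  -- `log x ≤ x - 1` at `x = m g / p`, so the optimal test is `g = p / m`.
  have h := Real.log_le_sub_one_of_pos (show 0 < m * g / p by positivity)
  rw [Real.log_div (by positivity) hp.ne', Real.log_mul hm.ne' hg.ne'] at h
  have h2 := mul_le_mul_of_nonneg_left h hp.le
  have h3 : p * (m * g / p - 1) = m * g - p := by field_simp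
  nlinarith

/-- Dual lower bound for the entropy lost when a fair coin decides whether to apply an
involution. -/
theorem sumMulLog_sub_average_ge {α : Type*} [Fintype α] (s : Equiv.Perm α)
    (hs : ∀ a, s (s a) = a) {q g : α → ℝ} (hq : ∀ a, 0 ≤ q a) (hg : ∀ a, 0 ≤ g a)
    (hqg : ∀ a, 0 < q a → 0 < g a) :
    ∑ a, q a * (Real.log (g a) + 1 - g a / 2 - g (s a) / 2) ≤
      sumMulLog q - sumMulLog (fun a => (q a + q (s a)) / 2) := by
  set m : α → ℝ := fun a => (q a + q (s a)) / 2 with hm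
  have hms : ∀ a, m (s a) = m a := fun a => by simp only [hm, hs]; ring
  have key : ∀ f : α → ℝ, ∑ a, m a * f a = ∑ a, q a * ((f a + f (s a)) / 2) := by
    intro f
    have h1 : ∑ a, q (s a) * f a = ∑ a, q a * f (s a) := by
      rw [← Equiv.sum_comp s fun a => q a * f (s a)]
      simp [hs]
    calc ∑ a, m a * f a = (∑ a, q a * f a) / 2 + (∑ a, q (s a) * f a) / 2 := by
          rw [Finset.sum_div, Finset.sum_div, ← Finset.sum_add_distrib]
          exact Finset.sum_congr rfl fun a _ => by simp only [hm]; ring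
      _ = _ := by
          rw [h1, Finset.sum_div, Finset.sum_div, ← Finset.sum_add_distrib]
          exact Finset.sum_congr rfl fun a _ => by ring
  -- The average `m` is invariant under `s`, so integrating `log m` against `m` or `q` gives the
  -- same value.
  have e1 : sumMulLog m = ∑ a, q a * Real.log (m a) := by
    rw [sumMulLog, key fun a => Real.log (m a)]
    exact Finset.sum_congr rfl fun a _ => by rw [hms]; ring
  have e2 := key g
  have e3 : ∑ a, q a * (Real.log (g a) + 1 - g a / 2 - g (s a) / 2) =
      ∑ a, (q a * Real.log (g a) + q a - m a * g a) := by
    rw [Finset.sum_sub_distrib, e2, ← Finset.sum_sub_distrib]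
    exact Finset.sum_congr rfl fun a _ => by ring
  rw [e1, e3, sumMulLog, ← Finset.sum_sub_distrib]
  refine Finset.sum_le_sum fun a _ => mul_log_sub_log_ge (hq a) ?_ (hg a) ?_ (hqg a)
  · exact div_nonneg (add_nonneg (hq _) (hq _)) zero_le_two
  · exact fun h => half_pos (add_pos_of_pos_of_nonneg h (hq _))

/-! ### Independent fair exchanges between two halves. -/

/-- Exchange the coordinates of `l` and `r` on which `z` is true. -/
def swapOn {W C : Type*} (z : W → Bool) (x : (W → C) × (W → C)) : (W → C) × (W → C) :=
  (fun i => bif z i then x.2 i else x.1 i, fun i => bif z i then x.1 i else x.2 i)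

theorem swapOn_swapOn {W C : Type*} (z z' : W → Bool) (x : (W → C) × (W → C)) :
    swapOn z (swapOn z' x) = swapOn (fun i => xor (z i) (z' i)) x := by
  ext i <;> simp only [swapOn] <;> cases z i <;> cases z' i <;> rfl

theorem swapOn_false {W C : Type*} (x : (W → C) × (W → C)) :
    swapOn (fun _ => false) x = x := rfl

/-- `swapOn z` as a permutation. -/
def swapPerm {W C : Type*} (z : W → Bool) : Equiv.Perm ((W → C) × (W → C)) where
  toFun := swapOn z
  invFun := swapOn z
  left_inv x := by rw [swapOn_swapOn]; simp [swapOn_false]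
  right_inv x := by rw [swapOn_swapOn]; simp [swapOn_false]

@[simp] theorem swapPerm_apply {W C : Type*} (z : W → Bool) (x : (W → C) × (W → C)) :
    swapPerm z x = swapOn z x := rfl

/-- The mean of a function over a finite type. -/
noncomputable def mean {ι : Type*} [Fintype ι] (f : ι → ℝ) : ℝ :=
  (∑ i, f i) / Fintype.card ι

theorem mean_comp_equiv {ι κ : Type*} [Fintype ι] [Fintype κ] (e : ι ≃ κ) (f : κ → ℝ) :
    mean (fun i => f (e i)) = mean f := by
  rw [mean, mean, e.sum_comp f, Fintype.card_congr e]

theorem mean_nonneg {ι : Type*} [Fintype ι] {f : ι → ℝ} (h : ∀ i, 0 ≤ f i) : 0 ≤ mean f :=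
  div_nonneg (Finset.sum_nonneg fun i _ => h i) (Nat.cast_nonneg _)

theorem mean_add {ι : Type*} [Fintype ι] (f g : ι → ℝ) :
    mean (fun i => f i + g i) = mean f + mean g := by
  rw [mean, Finset.sum_add_distrib, add_div]; rfl

theorem mean_const {ι : Type*} [Fintype ι] [Nonempty ι] (c : ℝ) : mean (fun _ : ι => c) = c := by
  rw [mean, Finset.sum_const, Finset.card_univ, nsmul_eq_mul]
  field_simp

theorem sum_mean_comm {ι α : Type*} [Fintype ι] [Fintype α] (f : α → ι → ℝ) :
    ∑ a, mean (f a) = mean (fun i => ∑ a, f a i) := by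
  simp only [mean]
  rw [← Finset.sum_div, Finset.sum_comm]

theorem exists_ne_zero_of_mean_ne_zero {ι : Type*} [Fintype ι] {f : ι → ℝ} (h : mean f ≠ 0) :
    ∃ i, f i ≠ 0 := by
  by_contra! h0
  exact h (by simp [mean, h0])

/-- Independent fair coins decide, for each `i`, whether `l i` and `r i` are exchanged. -/
noncomputable def coinSwap {W C : Type*} [Fintype W] [DecidableEq W]
    (p : (W → C) × (W → C) → ℝ) (x : (W → C) × (W → C)) : ℝ :=
  mean fun z : W → Bool => p (swapOn z x)

/-- `coinSwap` restricted to the coordinates from `j` on. -/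
noncomputable def coinSwapFrom {N : ℕ} {C : Type*} (j : ℕ)
    (p : (Fin N → C) × (Fin N → C) → ℝ) (x : (Fin N → C) × (Fin N → C)) : ℝ :=
  mean fun z : Fin N → Bool => p (swapOn (fun i => decide (j ≤ i.val) && z i) x)

theorem coinSwapFrom_zero {N : ℕ} {C : Type*} (p : (Fin N → C) × (Fin N → C) → ℝ) :
    coinSwapFrom 0 p = coinSwap p := by
  funext x; simp [coinSwapFrom, coinSwap]

theorem coinSwapFrom_self {N : ℕ} {C : Type*} (p : (Fin N → C) × (Fin N → C) → ℝ) :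
    coinSwapFrom N p = p := by
  funext x
  have h : ∀ i : Fin N, decide (N ≤ i.val) = false := fun i => by simp
  simp [coinSwapFrom, h, swapOn_false, mean_const]

/-- The identity that lets the coins act one at a time, from the last coordinate down to the first:
pairing each `z` with its flip at `k` isolates coin `k`. -/
theorem coinSwapFrom_succ {N : ℕ} {C : Type*} (p : (Fin N → C) × (Fin N → C) → ℝ) (k : Fin N)
    (x : (Fin N → C) × (Fin N → C)) :
    coinSwapFrom k.val p x = (coinSwapFrom (k.val + 1) p x +
      coinSwapFrom (k.val + 1) p (swapOn (fun i => decide (i = k)) x)) / 2 := by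
  have hinv : Function.Involutive
      (fun (z : Fin N → Bool) (i : Fin N) => xor (z i) (decide (i = k))) := by
    intro z; funext i; simp
  have h1 : coinSwapFrom k.val p x = (coinSwapFrom k.val p x + coinSwapFrom k.val p x) / 2 := by
    ring
  rw [h1]
  congr 1
  conv_lhs =>
    arg 2
    rw [coinSwapFrom, ← mean_comp_equiv hinv.toPerm]
  simp only [coinSwapFrom, Function.Involutive.coe_toPerm]
  rw [← mean_add, ← mean_add]
  congr 1
  funext z
  simp only [swapOn_swapOn]
  have hmask : ∀ z' : Fin N → Bool, (∀ i, i ≠ k → z' i = z i) →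
      (fun i => decide (k.val ≤ i.val) && z' i) = fun i =>
        xor (decide (k.val + 1 ≤ i.val) && z i) (decide (i = k) && z' k) := by
    intro z' hz'
    funext i
    rcases lt_trichotomy i k with h | h | h
    · have h1 : ¬ (k.val ≤ i.val) := by simpa using h
      have h2 : ¬ (k.val + 1 ≤ i.val) := by omega
      simp [h1, h2, h.ne]
    · subst h; simp
    · have h1 : k.val ≤ i.val := by exact_mod_cast h.le
      have h2 : k.val + 1 ≤ i.val := h
      simp [h1, h2, h.ne', hz' i h.ne']
  rw [hmask z fun _ _ => rfl, hmask (fun i => xor (z i) (decide (i = k))) fun i hi => by simp [hi]]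
  cases hz : z k
  · simp
  · simp [add_comm]

/-- Coins that the test function cannot see may be removed from the law. -/
theorem sum_coinSwapFrom_mul {N : ℕ} {C : Type*} [Fintype C] (j : ℕ)
    (p f : (Fin N → C) × (Fin N → C) → ℝ)
    (hf : ∀ (z : Fin N → Bool) x, f (swapOn (fun i => decide (j ≤ i.val) && z i) x) = f x) :
    ∑ x, coinSwapFrom j p x * f x = ∑ x, p x * f x := by
  have h1 : ∀ x, coinSwapFrom j p x * f x = mean fun z : Fin N → Bool =>
      p (swapOn (fun i => decide (j ≤ i.val) && z i) x) *
        f (swapOn (fun i => decide (j ≤ i.val) && z i) x) := by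
    intro x
    simp only [hf, coinSwapFrom, mean]
    rw [← Finset.sum_mul]
    ring
  simp only [h1]
  rw [sum_mean_comm]
  have h2 : ∀ z : Fin N → Bool, ∑ x, p (swapOn (fun i => decide (j ≤ i.val) && z i) x) *
      f (swapOn (fun i => decide (j ≤ i.val) && z i) x) = ∑ x, p x * f x := fun z =>
    Equiv.sum_comp (swapPerm fun i => decide (j ≤ i.val) && z i) fun x => p x * f x
  simp only [h2, mean_const]

/-- Dual lower bound for the entropy lost under `coinSwap`: the coins are used one after the other,
and the `k`-th one is tested against a function of the first `k + 1` coordinates. -/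
theorem sum_sequential_test_le {N : ℕ} {C : Type*} [Fintype C]
    {p : (Fin N → C) × (Fin N → C) → ℝ} (hp : ∀ x, 0 ≤ p x)
    (g : Fin N → (Fin N → C) → ℝ) (hg : ∀ k r, 0 ≤ g k r)
    (hdep : ∀ k r r', (∀ i ≤ k, r i = r' i) → g k r = g k r')
    (hpos : ∀ k x, 0 < p x → 0 < g k x.2) :
    ∑ k, ∑ x, p x * (Real.log (g k x.2) + 1 - g k x.2 / 2 -
        g k (Function.update x.2 k (x.1 k)) / 2) ≤
      sumMulLog p - sumMulLog (coinSwap p) := by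
  have hfix : ∀ (k : Fin N) (z : Fin N → Bool) (x : (Fin N → C) × (Fin N → C)) (i : Fin N),
      i ≤ k → (swapOn (fun i => decide (k.val + 1 ≤ i.val) && z i) x).1 i = x.1 i ∧
      (swapOn (fun i => decide (k.val + 1 ≤ i.val) && z i) x).2 i = x.2 i := by
    intro k z x i hi
    have : ¬ (k.val + 1 ≤ i.val) := by have : i.val ≤ k.val := hi; omega
    have h2 : decide (k.val + 1 ≤ i.val) = false := by simpa using this
    simp only [swapOn, h2, Bool.false_and, cond_false, and_self]
  have hstep : ∀ k : Fin N, ∑ x, p x * (Real.log (g k x.2) + 1 - g k x.2 / 2 -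
        g k (Function.update x.2 k (x.1 k)) / 2) ≤
      sumMulLog (coinSwapFrom (k.val + 1) p) - sumMulLog (coinSwapFrom k.val p) := by
    intro k
    have h := sumMulLog_sub_average_ge (swapPerm fun i => decide (i = k))
      (fun a => (swapPerm fun i => decide (i = k)).left_inv a)
      (q := coinSwapFrom (k.val + 1) p) (g := fun x => g k x.2)
      (fun x => mean_nonneg fun z => hp _) (fun x => hg _ _) (by
        intro x hx
        obtain ⟨z, hz⟩ := exists_ne_zero_of_mean_ne_zero hx.ne'
        have := hpos k _ (lt_of_le_of_ne (hp _) hz.symm)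
        rwa [hdep k _ x.2 fun i hi => (hfix k z x i hi).2] at this)
    simp only [swapPerm_apply, ← coinSwapFrom_succ] at h
    refine le_trans (le_of_eq ?_) h
    -- The test for coin `k` reads only coordinates up to `k`, untouched by the coins already used,
    -- so its expectation may be taken under the original `p`.
    rw [← sum_coinSwapFrom_mul (k.val + 1)]
    · refine Finset.sum_congr rfl fun x _ => ?_
      rw [hdep k (swapOn (fun i => decide (i = k)) x).2 (Function.update x.2 k (x.1 k))]
      intro i _
      by_cases hik : i = k
      · subst hik; simp [swapOn]
      · simp [swapOn, hik]
    · intro z x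
      rw [hdep k _ x.2 fun i hi => (hfix k z x i hi).2,
        hdep k (Function.update _ k _) (Function.update x.2 k (x.1 k))]
      intro i hi
      by_cases hik : i = k
      · subst hik; simpa using (hfix i z x i hi).1
      · simpa [hik] using (hfix k z x i hi).2
  refine (Finset.sum_le_sum fun k _ => hstep k).trans (le_of_eq ?_)
  rw [Fin.sum_univ_eq_sum_range (fun k => sumMulLog (coinSwapFrom (k + 1) p) -
    sumMulLog (coinSwapFrom k p)) N,
    Finset.sum_range_sub (fun k => sumMulLog (coinSwapFrom k p)), coinSwapFrom_self,
    coinSwapFrom_zero]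

/-- If, given the right half, the label at every left position is uniform on the labels that the
right half misses, then the dual bound only involves the law of the right half. -/
theorem sum_right_test_le {N : ℕ} {C : Type*} [Fintype C] [DecidableEq C]
    {A : Finset C} {p : (Fin N → C) × (Fin N → C) → ℝ} (hp : ∀ x, 0 ≤ p x)
    (hunif : ∀ (r : Fin N → C) (k : Fin N) (φ : C → ℝ), ∑ l, p (l, r) * φ (l k) =
      (∑ l, p (l, r)) * ((∑ b ∈ A with ∀ i, r i ≠ b, φ b) / N))
    (g : Fin N → (Fin N → C) → ℝ) (hg : ∀ k r, 0 ≤ g k r)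
    (hdep : ∀ k r r', (∀ i ≤ k, r i = r' i) → g k r = g k r')
    (hpos : ∀ k x, 0 < p x → 0 < g k x.2) :
    ∑ k, ∑ r, (∑ l, p (l, r)) * (Real.log (g k r) + 1 - g k r / 2 -
        (∑ b ∈ A with ∀ i, r i ≠ b, g k (Function.update r k b)) / N / 2) ≤
      sumMulLog p - sumMulLog (coinSwap p) := by
  refine le_trans (le_of_eq ?_) (sum_sequential_test_le hp g hg hdep hpos)
  refine Finset.sum_congr rfl fun k _ => ?_
  rw [Fintype.sum_prod_type_right]
  refine Finset.sum_congr rfl fun r _ => ?_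
  have h := hunif r k fun b => g k (Function.update r k b)
  have h2 : ∀ l, p (l, r) * (Real.log (g k r) + 1 - g k r / 2 -
      g k (Function.update r k (l k)) / 2) = p (l, r) * (Real.log (g k r) + 1 - g k r / 2) -
        p (l, r) * g k (Function.update r k (l k)) / 2 := fun l => by ring
  simp only [h2]
  rw [Finset.sum_sub_distrib, ← Finset.sum_mul, ← Finset.sum_div, h]
  ring

/-! ### Revealing the right half label by label. -/

/-- The mass of the sequences that agree with `r` on the first `k` coordinates. -/
noncomputable def prefixMass {N : ℕ} {C : Type*} [Fintype C] [DecidableEq C]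
    (τ : (Fin N → C) → ℝ) (k : ℕ) (r : Fin N → C) : ℝ :=
  ∑ r', if ∀ i : Fin N, i.val < k → r' i = r i then τ r' else 0

/-- The labels of `A` that do not occur among the first `k` coordinates of `r`. -/
def remaining {N : ℕ} {C : Type*} [DecidableEq C] (A : Finset C) (k : ℕ)
    (r : Fin N → C) : Finset C :=
  A.filter fun b => ∀ i : Fin N, i.val < k → r i ≠ b

/-- The density, relative to the uniform distribution on the remaining labels, of coordinate `k`
given the earlier ones. -/
noncomputable def stepDensity {N : ℕ} {C : Type*} [Fintype C] [DecidableEq C] (M : ℕ)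
    (τ : (Fin N → C) → ℝ) (k : Fin N) (r : Fin N → C) : ℝ :=
  ((M : ℝ) - k.val) * prefixMass τ (k.val + 1) r / prefixMass τ k.val r

section
variable {N : ℕ} {C : Type*} [Fintype C] [DecidableEq C] {τ : (Fin N → C) → ℝ}
  {A : Finset C} {M : ℕ}

theorem prefixMass_congr {k : ℕ} {r r' : Fin N → C} (h : ∀ i : Fin N, i.val < k → r i = r' i) :
    prefixMass τ k r = prefixMass τ k r' := by
  refine Finset.sum_congr rfl fun s _ => ?_
  congr 1
  refine propext (forall_congr' fun i => forall_congr' fun hi => ?_)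
  rw [h i hi]

theorem prefixMass_nonneg (hτ : ∀ r, 0 ≤ τ r) (k : ℕ) (r : Fin N → C) :
    0 ≤ prefixMass τ k r :=
  Finset.sum_nonneg fun s _ => by split_ifs <;> simp [hτ]

theorem le_prefixMass (hτ : ∀ r, 0 ≤ τ r) (k : ℕ) (r : Fin N → C) : τ r ≤ prefixMass τ k r := by
  have h := Finset.single_le_sum (f := fun r' : Fin N → C =>
    if ∀ i : Fin N, i.val < k → r' i = r i then τ r' else 0)
    (fun s _ => by split_ifs <;> simp [hτ]) (Finset.mem_univ r)
  simpa [prefixMass] using h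

theorem prefixMass_succ_le (hτ : ∀ r, 0 ≤ τ r) (k : ℕ) (r : Fin N → C) :
    prefixMass τ (k + 1) r ≤ prefixMass τ k r := by
  refine Finset.sum_le_sum fun s _ => ?_
  by_cases h : ∀ i : Fin N, i.val < k + 1 → s i = r i
  · rw [if_pos h, if_pos fun i hi => h i (by omega)]
  · rw [if_neg h]; split_ifs <;> simp [hτ]

theorem prefixMass_zero (r : Fin N → C) : prefixMass τ 0 r = ∑ s, τ s := by
  simp [prefixMass]

theorem prefixMass_self (r : Fin N → C) : prefixMass τ N r = τ r := by
  rw [prefixMass, Finset.sum_eq_single r]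
  · simp
  · intro s _ hs
    rw [if_neg]
    exact fun h => hs (funext fun i => h i i.2)
  · simp

theorem stepDensity_nonneg (hτ : ∀ r, 0 ≤ τ r) (hM : N ≤ M) (k : Fin N) (r : Fin N → C) :
    0 ≤ stepDensity M τ k r := by
  have : (k.val : ℝ) ≤ M := by exact_mod_cast k.2.le.trans hM
  exact div_nonneg (mul_nonneg (by linarith) (prefixMass_nonneg hτ _ _)) (prefixMass_nonneg hτ _ _)

theorem stepDensity_pos (hτ : ∀ r, 0 ≤ τ r) (hM : N ≤ M) (k : Fin N) {r : Fin N → C}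
    (hr : 0 < τ r) : 0 < stepDensity M τ k r := by
  have : (k.val : ℝ) < M := by exact_mod_cast k.2.trans_le hM
  exact div_pos (mul_pos (by linarith) (hr.trans_le (le_prefixMass hτ _ _)))
    (hr.trans_le (le_prefixMass hτ _ _))

theorem stepDensity_le (hτ : ∀ r, 0 ≤ τ r) (hM : N ≤ M) (k : Fin N) (r : Fin N → C) :
    stepDensity M τ k r ≤ M := by
  have : (k.val : ℝ) ≤ M := by exact_mod_cast k.2.le.trans hM
  rcases (prefixMass_nonneg hτ k.val r).eq_or_lt with h | h
  · rw [stepDensity, ← h]; simp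
  · rw [stepDensity, div_le_iff₀ h]
    have h1 := prefixMass_succ_le hτ k.val r
    have h2 : (0 : ℝ) ≤ k.val := Nat.cast_nonneg _
    nlinarith [mul_le_mul_of_nonneg_left h1 (show 0 ≤ (M : ℝ) - k.val by linarith)]

theorem stepDensity_congr {k : Fin N} {r r' : Fin N → C} (h : ∀ i ≤ k, r i = r' i) :
    stepDensity M τ k r = stepDensity M τ k r' := by
  rw [stepDensity, stepDensity, prefixMass_congr (k := k.val + 1) (r' := r'),
    prefixMass_congr (k := k.val) (r' := r')]
  · exact fun i hi => h i hi.le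
  · exact fun i hi => h i (Nat.lt_succ_iff.1 hi)

/-- The prefix masses telescope from the total mass to `τ r`, and the factors `M - k` multiply to
`M! / (M - N)!`. -/
theorem sum_log_stepDensity (hτ : ∀ r, 0 ≤ τ r) (hM : N ≤ M) {r : Fin N → C} (hr : 0 < τ r) :
    ∑ k, Real.log (stepDensity M τ k r) =
      Real.log (τ r) + Real.log M.factorial - Real.log (M - N).factorial
        - Real.log (∑ s, τ s) := by
  have hpos : ∀ k, 0 < prefixMass τ k r := fun k => hr.trans_le (le_prefixMass hτ _ _)
  have h1 : ∀ k : Fin N, Real.log (stepDensity M τ k r) =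
      (Real.log (prefixMass τ (k.val + 1) r) - Real.log (M - (k.val + 1)).factorial) -
        (Real.log (prefixMass τ k.val r) - Real.log (M - k.val).factorial) := by
    intro k
    have hk : (k.val : ℝ) < M := by exact_mod_cast k.2.trans_le hM
    have hk' : k.val < M := k.2.trans_le hM
    rw [stepDensity, Real.log_div (mul_ne_zero (by linarith) (hpos _).ne') (hpos _).ne',
      Real.log_mul (by linarith) (hpos _).ne']
    obtain ⟨j, hj⟩ : ∃ j, M - k.val = j + 1 := ⟨M - k.val - 1, by omega⟩
    have hj' : M - (k.val + 1) = j := by omega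
    have hj'' : (M : ℝ) - k.val = ((j + 1 : ℕ) : ℝ) := by
      rw [← hj, Nat.cast_sub hk'.le]
    rw [hj', hj'', hj, Nat.factorial_succ, Nat.cast_mul, Real.log_mul (by positivity)
      (by positivity)]
    ring
  simp only [h1]
  rw [Fin.sum_univ_eq_sum_range (fun k => (Real.log (prefixMass τ (k + 1) r) -
    Real.log (M - (k + 1)).factorial) - (Real.log (prefixMass τ k r) -
      Real.log (M - k).factorial)) N,
    Finset.sum_range_sub (fun k => Real.log (prefixMass τ k r) - Real.log (M - k).factorial),
    prefixMass_self, prefixMass_zero, Nat.sub_zero]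
  ring

omit [Fintype C] in
theorem card_remaining (hA : A.card = M) {r : Fin N → C} (hr : Function.Injective r)
    (hrA : ∀ i, r i ∈ A) (k : Fin N) : ((remaining A k.val r).card : ℝ) = (M : ℝ) - k.val := by
  have h1 : remaining A k.val r = A \ ((Finset.univ.filter fun i : Fin N => i.val < k.val).image r) := by
    ext b
    simp only [remaining, Finset.mem_filter, Finset.mem_sdiff, Finset.mem_image, Finset.mem_univ,
      true_and, not_exists, not_and]
  have h2 : (Finset.univ.filter fun i : Fin N => i.val < k.val).image r ⊆ A := by
    intro b hb
    obtain ⟨i, -, rfl⟩ := Finset.mem_image.1 hb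
    exact hrA i
  have h3 : ((Finset.univ.filter fun i : Fin N => i.val < k.val).image r).card = k.val := by
    rw [Finset.card_image_of_injective _ hr]
    have : (Finset.univ.filter fun i : Fin N => i.val < k.val) = Finset.Iio k := by
      ext i; simp
    rw [this, Fin.card_Iio]
  have h4 := Finset.card_le_card h2
  rw [h1, Finset.card_sdiff_of_subset h2, Nat.cast_sub h4, h3, hA]

/-- Expectation when coordinate `k` is resampled uniformly from the remaining labels. -/
noncomputable def resample (A : Finset C) (M : ℕ) (τ : (Fin N → C) → ℝ) (k : Fin N)
    (φ : (Fin N → C) → ℝ) : ℝ :=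
  ∑ r, τ r * ((∑ b ∈ remaining A k.val r, φ (Function.update r k b)) / ((M : ℝ) - k.val))

theorem resample_mono (hτ : ∀ r, 0 ≤ τ r) (hM : N ≤ M) {k : Fin N} {φ ψ : (Fin N → C) → ℝ}
    (h : ∀ r, φ r ≤ ψ r) : resample A M τ k φ ≤ resample A M τ k ψ := by
  have : (k.val : ℝ) ≤ M := by exact_mod_cast k.2.le.trans hM
  refine Finset.sum_le_sum fun r _ => mul_le_mul_of_nonneg_left ?_ (hτ r)
  exact div_le_div_of_nonneg_right (Finset.sum_le_sum fun b _ => h _) (by linarith)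

theorem resample_add (k : Fin N) (φ ψ : (Fin N → C) → ℝ) :
    resample A M τ k (fun r => φ r + ψ r) = resample A M τ k φ + resample A M τ k ψ := by
  simp only [resample, Finset.sum_add_distrib, add_div, mul_add]

theorem resample_mul (k : Fin N) (c : ℝ) (φ : (Fin N → C) → ℝ) :
    resample A M τ k (fun r => c * φ r) = c * resample A M τ k φ := by
  simp only [resample, ← Finset.mul_sum]
  rw [Finset.mul_sum]
  exact Finset.sum_congr rfl fun r _ => by ring

theorem resample_one (hsupp : ∀ r, τ r ≠ 0 → Function.Injective r ∧ ∀ i, r i ∈ A)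
    (hA : A.card = M) (hM : N ≤ M) (k : Fin N) :
    resample A M τ k (fun _ => 1) = ∑ r, τ r := by
  have : (k.val : ℝ) < M := by exact_mod_cast k.2.trans_le hM
  refine Finset.sum_congr rfl fun r _ => ?_
  by_cases h : τ r = 0
  · simp [h]
  · rw [Finset.sum_const, nsmul_eq_mul, card_remaining hA (hsupp r h).1 (hsupp r h).2, mul_one,
      div_self (by linarith), mul_one]

/-- Change of measure: `stepDensity` is the density of coordinate `k` with respect to
resampling. -/
theorem resample_stepDensity_mul (hτ : ∀ r, 0 ≤ τ r)
    (hsupp : ∀ r, τ r ≠ 0 → Function.Injective r ∧ ∀ i, r i ∈ A) (hM : N ≤ M) (k : Fin N)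
    (φ : (Fin N → C) → ℝ) (hφ : ∀ r r', (∀ i ≤ k, r i = r' i) → φ r = φ r') :
    resample A M τ k (fun r => stepDensity M τ k r * φ r) = ∑ r, τ r * φ r := by
  have hk : (k.val : ℝ) < M := by exact_mod_cast k.2.trans_le hM
  have hk' : (M : ℝ) - k.val ≠ 0 := by linarith
  -- Each `r'` of nonzero mass sharing the prefix of `r` is counted for exactly one `b`, namely `r'
  -- k`, which is still remaining because `r'` is injective with labels in `A`.
  have inner : ∀ r, (∑ b ∈ remaining A k.val r, prefixMass τ (k.val + 1) (Function.update r k b) *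
      φ (Function.update r k b)) =
      ∑ r', if ∀ i : Fin N, i.val < k.val → r' i = r i then τ r' * φ r' else 0 := by
    intro r
    simp only [prefixMass, Finset.sum_mul]
    rw [Finset.sum_comm]
    refine Finset.sum_congr rfl fun r' _ => ?_
    by_cases h0 : τ r' = 0
    · simp [h0]
    by_cases hag : ∀ i : Fin N, i.val < k.val → r' i = r i
    · rw [if_pos hag, Finset.sum_eq_single (r' k)]
      · rw [if_pos, hφ (Function.update r k (r' k)) r']
        · intro i hi
          rcases hi.eq_or_lt with rfl | hi
          · simp
          · simp [hi.ne, hag i hi]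
        · intro i hi
          rcases (Nat.lt_succ_iff.1 hi).eq_or_lt with h | h
          · obtain rfl : i = k := Fin.ext h
            simp
          · have : i ≠ k := fun h' => by simp [h'] at h
            simp [this, hag i h]
      · intro b _ hb
        rw [if_neg, zero_mul]
        intro h
        exact hb (by simpa using (h k (Nat.lt_succ_self _)).symm)
      · intro hn
        exfalso
        refine hn (Finset.mem_filter.2 ⟨(hsupp r' h0).2 k, fun i hi h => ?_⟩)
        rw [← hag i hi] at h
        have := (hsupp r' h0).1 h
        simp [this] at hi
    · rw [if_neg hag]
      refine Finset.sum_eq_zero fun b _ => ?_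
      rw [if_neg, zero_mul]
      intro h
      refine hag fun i hi => ?_
      have hik : i ≠ k := fun h' => by simp [h'] at hi
      simpa [hik] using h i (Nat.lt_succ_of_lt hi)
  have h1 : ∀ r, (∑ b ∈ remaining A k.val r, stepDensity M τ k (Function.update r k b) *
      φ (Function.update r k b)) / ((M : ℝ) - k.val) = (prefixMass τ k.val r)⁻¹ *
      ∑ r', if ∀ i : Fin N, i.val < k.val → r' i = r i then τ r' * φ r' else 0 := by
    intro r
    rw [← inner, Finset.sum_div, Finset.mul_sum]
    refine Finset.sum_congr rfl fun b _ => ?_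
    rw [stepDensity, prefixMass_congr (k := k.val) (r := Function.update r k b) (r' := r)]
    · field_simp
    · intro i hi
      have hik : i ≠ k := fun h' => by simp [h'] at hi
      simp [hik]
  simp only [resample, h1, Finset.mul_sum]
  rw [Finset.sum_comm]
  refine Finset.sum_congr rfl fun r' _ => ?_
  rcases (hτ r').eq_or_lt with h0 | h0
  · simp [← h0]
  have h2 : ∀ r, τ r * ((prefixMass τ k.val r)⁻¹ *
      if ∀ i : Fin N, i.val < k.val → r' i = r i then τ r' * φ r' else 0) =
      (if ∀ i : Fin N, i.val < k.val → r i = r' i then τ r else 0) *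
        ((prefixMass τ k.val r')⁻¹ * (τ r' * φ r')) := by
    intro r
    by_cases hag : ∀ i : Fin N, i.val < k.val → r i = r' i
    · rw [if_pos hag, if_pos fun i hi => (hag i hi).symm, prefixMass_congr hag]
    · rw [if_neg hag, if_neg fun h => hag fun i hi => (h i hi).symm]
      simp
  simp only [h2]
  rw [← Finset.sum_mul]
  change prefixMass τ k.val r' * _ = _
  have := (h0.trans_le (le_prefixMass hτ k.val r')).ne'
  field_simp

/-- For an exchangeable law, the test function `2 t / (1 + t)` detects a `1 / (72 L)` fraction of
the entropy of coordinate `k` given the earlier ones. -/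
theorem sum_test_ge (hτ : ∀ r, 0 ≤ τ r)
    (hsupp : ∀ r, τ r ≠ 0 → Function.Injective r ∧ ∀ i, r i ∈ A) (hA : A.card = N + N)
    (hsymm : ∀ (h : Equiv.Perm (Fin N)) r, τ (r ∘ h) = τ r) {L : ℝ} (hL : 1 / 2 ≤ L)
    (hlog : Real.log (N + N : ℕ) ≤ L) (k : Fin N) (g : (Fin N → C) → ℝ)
    (hg : ∀ r, g r = 2 * stepDensity (N + N) τ k r / (1 + stepDensity (N + N) τ k r)) :
    1 / (72 * L) * ∑ r, τ r * Real.log (stepDensity (N + N) τ k r) ≤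
      ∑ r, τ r * (Real.log (g r) + 1 - g r / 2 -
        (∑ b ∈ A with ∀ i, r i ≠ b, g (Function.update r k b)) / N / 2) := by
  have hM : N ≤ N + N := by omega
  set t := stepDensity (N + N) τ k with ht
  have ht0 : ∀ r, 0 ≤ t r := fun r => stepDensity_nonneg hτ hM k r
  have htdep : ∀ r r', (∀ i ≤ k, r i = r' i) → t r = t r' := fun r r' h => stepDensity_congr h
  have hgdep : ∀ r r', (∀ i ≤ k, r i = r' i) → g r = g r' := fun r r' h => by
    rw [hg, hg, htdep r r' h]
  have cm := resample_stepDensity_mul (M := N + N) hτ hsupp hM k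
  have h1 : resample A (N + N) τ k (fun _ => 1) = ∑ r, τ r := resample_one hsupp hA hM k
  have ht1 : resample A (N + N) τ k t = ∑ r, τ r := by
    have := cm (fun _ => 1) fun _ _ _ => rfl
    simpa using this
  have hN : (0 : ℝ) < N := by exact_mod_cast k.pos
  -- the logarithmic part
  have hlogpart : 1 / (72 * L) * ∑ r, τ r * Real.log (t r) ≤ ∑ r, τ r * Real.log (g r) := by
    rw [← cm (fun r => Real.log (t r)) fun r r' h => by rw [htdep r r' h],
      ← cm (fun r => Real.log (g r)) fun r r' h => by rw [hgdep r r' h]]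
    -- Under resampling `t` has the same total as `1`, so the terms `1 - t` added for the pointwise
    -- comparison cancel.
    have hle : resample A (N + N) τ k (fun r => t r * Real.log (t r) + ((-1) * t r + 1)) ≤
        resample A (N + N) τ k
          (fun r => (72 * L) * (t r * Real.log (g r) + ((1 / 2) * 1 + (-1 / 2) * t r))) := by
      refine resample_mono hτ hM fun r => ?_
      have hlt : Real.log (t r) ≤ L := by
        rcases (ht0 r).eq_or_lt with h | h
        · rw [← h, Real.log_zero]; linarith
        · exact (Real.log_le_log h (stepDensity_le hτ hM k r)).trans hlog
      have := mul_log_le_midpoint (ht0 r) hL hlt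
      rw [← hg] at this
      calc _ = t r * Real.log (t r) - t r + 1 := by ring
        _ ≤ _ := this
        _ = _ := by ring
    rw [resample_mul, resample_add, resample_add, resample_mul, resample_add, resample_add,
      resample_mul, resample_mul, h1, ht1] at hle
    have hLpos : 0 < 72 * L := by linarith
    rw [div_mul_eq_mul_div, one_mul, div_le_iff₀ hLpos]
    linarith
  -- the linear part
  set G := ∑ r, τ r * g r with hG
  set U := resample A (N + N) τ k g with hU
  have hGt : resample A (N + N) τ k (fun r => t r * g r) = G := cm g hgdep
  -- Because `t g + g = 2 t`.
  have hsum : G + U = 2 * ∑ r, τ r := by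
    rw [← hGt, hU, ← resample_add, ← ht1, ← resample_mul]
    congr 1
    funext r
    have := ht0 r
    rw [hg]; field_simp
    ring
  -- From `(t - 1) (g - 1) = (t - 1) ^ 2 / (1 + t) ≥ 0`: `g` is biased towards large `t`.
  have hUG : U ≤ G := by
    have : resample A (N + N) τ k (fun r => t r + (-1) * 1) ≤
        resample A (N + N) τ k (fun r => t r * g r + (-1) * g r) := by
      refine resample_mono hτ hM fun r => ?_
      have h := ht0 r
      rw [hg, ← sub_nonneg]
      have : t r * (2 * t r / (1 + t r)) + -1 * (2 * t r / (1 + t r)) - (t r + -1 * 1) =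
        (t r - 1) ^ 2 / (1 + t r) := by field_simp; ring
      rw [this]; positivity
    rw [resample_add, resample_add, resample_mul, resample_mul, ht1, h1, hGt] at this
    linarith
  -- The test sees only the first `k + 1` coordinates, where putting `r i` at `k` looks like the
  -- transposition of `k` and `i`; exchangeability concludes.
  have hswap : ∀ i : Fin N, k ≤ i → ∑ r, τ r * g (Function.update r k (r i)) = G := by
    intro i hi
    rw [hG, ← Equiv.sum_comp (Equiv.arrowCongr (Equiv.swap k i) (Equiv.refl C))
      fun r => τ r * g r]
    refine Finset.sum_congr rfl fun r _ => ?_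
    have e : (Equiv.arrowCongr (Equiv.swap k i) (Equiv.refl C)) r = r ∘ Equiv.swap k i := by
      funext j; simp [Equiv.arrowCongr]
    rw [e, hsymm, hgdep (Function.update r k (r i)) (r ∘ Equiv.swap k i)]
    intro j hj
    rcases hj.eq_or_lt with rfl | hj
    · simp
    · simp [hj.ne, Equiv.swap_apply_of_ne_of_ne hj.ne (hj.trans_le hi).ne]
  -- The labels missed by the whole right half are those remaining at step `k`, less the ones at
  -- positions `i ≥ k`. Thus the incoming label is not uniform on the remaining labels, but the
  -- correction has the favourable sign since `U ≤ G`.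
  have hsplit : ∑ r, τ r * (∑ b ∈ A with ∀ i, r i ≠ b, g (Function.update r k b)) =
      ((N + N : ℕ) - k.val : ℝ) * U - (N - k.val : ℝ) * G := by
    have hk : (k.val : ℝ) < (N + N : ℕ) := by exact_mod_cast k.2.trans_le hM
    have e1 : ∑ r, τ r * (∑ b ∈ remaining A k.val r, g (Function.update r k b)) =
        ((N + N : ℕ) - k.val : ℝ) * U := by
      rw [hU, resample, Finset.mul_sum]
      refine Finset.sum_congr rfl fun r _ => ?_
      have : ((N + N : ℕ) : ℝ) - k.val ≠ 0 := by linarith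
      field_simp
    have e2 : ∑ r, τ r * (∑ i ∈ Finset.Ici k, g (Function.update r k (r i))) =
        (N - k.val : ℝ) * G := by
      simp only [Finset.mul_sum]
      rw [Finset.sum_comm, Finset.sum_congr rfl fun i hi => hswap i (Finset.mem_Ici.1 hi),
        Finset.sum_const, Fin.card_Ici, nsmul_eq_mul, Nat.cast_sub k.2.le]
    rw [← e1, ← e2, ← Finset.sum_sub_distrib]
    refine Finset.sum_congr rfl fun r _ => ?_
    by_cases h0 : τ r = 0
    · simp [h0]
    obtain ⟨hinj, hmem⟩ := hsupp r h0
    rw [← mul_sub]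
    congr 1
    have e3 : ∑ i ∈ Finset.Ici k, g (Function.update r k (r i)) =
        ∑ b ∈ (Finset.Ici k).image r, g (Function.update r k b) :=
      (Finset.sum_image (f := fun b => g (Function.update r k b)) fun _ _ _ _ h => hinj h).symm
    have hsub : (Finset.Ici k).image r ⊆ remaining A k.val r := by
      intro b hb
      obtain ⟨i, hi, rfl⟩ := Finset.mem_image.1 hb
      refine Finset.mem_filter.2 ⟨hmem i, fun j hj h => ?_⟩
      have := hinj h
      subst this
      exact absurd hj (not_lt.2 (show k ≤ j from Finset.mem_Ici.1 hi))
    rw [e3, ← Finset.sum_sdiff hsub, add_sub_cancel_right]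
    refine Finset.sum_congr ?_ fun _ _ => rfl
    ext b
    simp only [remaining, Finset.mem_filter, Finset.mem_sdiff, Finset.mem_image, Finset.mem_Ici,
      not_exists, not_and]
    constructor
    · rintro ⟨hb, h⟩
      exact ⟨⟨hb, fun i _ => h i⟩, fun i _ => h i⟩
    · rintro ⟨⟨hb, h⟩, h'⟩
      refine ⟨hb, fun i => ?_⟩
      rcases lt_or_ge i k with hi | hi
      · exact h i hi
      · exact h' i hi
  have hlin : ∑ r, τ r * (Real.log (g r) + 1 - g r / 2 -
      (∑ b ∈ A with ∀ i, r i ≠ b, g (Function.update r k b)) / N / 2) =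
      ∑ r, τ r * Real.log (g r) + (∑ r, τ r - G / 2 -
        (((N + N : ℕ) - k.val : ℝ) * U - (N - k.val : ℝ) * G) / N / 2) := by
    rw [← hsplit, hG, Finset.sum_div, Finset.sum_div, Finset.sum_div, ← Finset.sum_sub_distrib,
      ← Finset.sum_sub_distrib, ← Finset.sum_add_distrib]
    exact Finset.sum_congr rfl fun r _ => by ring
  have hrest : ∑ r, τ r - G / 2 -
        (((N + N : ℕ) - k.val : ℝ) * U - (N - k.val : ℝ) * G) / N / 2 =
        (1 - k.val / N) * (G - U) / 2 := by
    have : ∑ r, τ r = (G + U) / 2 := by linarith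
    rw [this]; push_cast; field_simp; ring
  have hkN : (k.val : ℝ) / N ≤ 1 := by
    rw [div_le_one hN]; exact_mod_cast k.2.le
  rw [hlin, hrest]
  have : 0 ≤ (1 - (k.val : ℝ) / N) * (G - U) / 2 :=
    div_nonneg (mul_nonneg (by linarith) (by linarith)) zero_le_two
  linarith

end

/-! ### The butterfly network and its one-point marginals. -/

/-- Split a labelling of the cube by the first bit. -/
def halves (d : ℕ) (C : Type*) : (Cube (d + 1) → C) ≃ (Cube d → C) × (Cube d → C) where
  toFun f := (fun y => f (Fin.cons false y), fun y => f (Fin.cons true y))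
  invFun x u := bif u 0 then x.2 (Fin.tail u) else x.1 (Fin.tail u)
  left_inv f := by
    funext u
    have hu := Fin.cons_self_tail u
    cases h : u 0 <;> rw [h] at hu
    · simpa [h] using congrArg f hu
    · simpa [h] using congrArg f hu
  right_inv x := by simp

theorem sum_cube_succ {d : ℕ} (φ : Cube (d + 1) → ℝ) :
    ∑ u, φ u = ∑ y : Cube d, φ (Fin.cons false y) + ∑ y : Cube d, φ (Fin.cons true y) := by
  rw [← (Fin.consEquiv fun _ : Fin (d + 1) => Bool).sum_comp, Fintype.sum_prod_type,
    Fintype.sum_bool, add_comm]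
  rfl

/-- Apply an operator to the left half, with the right half fixed. -/
def onLeft {X Y : Type*} (T : (X → ℝ) → X → ℝ) (p : X × Y → ℝ) (x : X × Y) : ℝ :=
  T (fun l => p (l, x.2)) x.1

/-- Apply an operator to the right half, with the left half fixed. -/
def onRight {X Y : Type*} (T : (Y → ℝ) → Y → ℝ) (p : X × Y → ℝ) (x : X × Y) : ℝ :=
  T (fun r => p (x.1, r)) x.2

/-- The action on laws of the random butterfly network: the halves of the cube are mixed
recursively, then fair coins decide which pairs of opposite positions are exchanged. -/
noncomputable def butterfly {C : Type*} : (d : ℕ) → ((Cube d → C) → ℝ) → (Cube d → C) → ℝ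
  | 0, q => q
  | d + 1, q => fun f => coinSwap (onLeft (butterfly d) (onRight (butterfly d)
      fun x => q ((halves d C).symm x))) (halves d C f)

section
variable {C : Type*}

theorem butterfly_nonneg {d : ℕ} {q : (Cube d → C) → ℝ} (hq : ∀ f, 0 ≤ q f) (f : Cube d → C) :
    0 ≤ butterfly d q f := by
  induction d with
  | zero => exact hq f
  | succ d ih =>
    exact mean_nonneg fun z => ih (fun l => ih (fun r => hq _) _) _

/-- The network only permutes the labels. -/
theorem butterfly_support {d : ℕ} {q : (Cube d → C) → ℝ} {f : Cube d → C}
    (h : butterfly d q f ≠ 0) :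
    ∃ f', q f' ≠ 0 ∧ ∀ φ : C → ℝ, ∑ u, φ (f u) = ∑ u, φ (f' u) := by
  induction d with
  | zero => exact ⟨f, h, fun _ => rfl⟩
  | succ d ih =>
    obtain ⟨z, hz⟩ := exists_ne_zero_of_mean_ne_zero h
    obtain ⟨l, hl, hl'⟩ := ih hz
    obtain ⟨r, hr, hr'⟩ := ih hl
    refine ⟨_, hr, fun φ => ?_⟩
    rw [sum_cube_succ, sum_cube_succ]
    change _ = ∑ y, φ (((halves d C) ((halves d C).symm (l, r))).1 y) +
      ∑ y, φ (((halves d C) ((halves d C).symm (l, r))).2 y)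
    rw [Equiv.apply_symm_apply, ← hl', ← hr', ← Finset.sum_add_distrib, ← Finset.sum_add_distrib]
    refine Finset.sum_congr rfl fun y _ => ?_
    simp only [swapOn, halves, Equiv.coe_fn_mk]
    cases z y <;> simp [add_comm]

variable [Fintype C]

/-- The coin average is self-adjoint, since each exchange is an involution. -/
theorem sum_coinSwap_mul {W : Type*} [Fintype W] [DecidableEq W] (p F : (W → C) × (W → C) → ℝ) :
    ∑ x, coinSwap p x * F x = ∑ x, p x * mean fun z : W → Bool => F (swapOn z x) := by
  have h1 : ∀ x, coinSwap p x * F x = mean fun z : W → Bool => p (swapOn z x) * F x := by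
    intro x
    simp only [coinSwap, mean]
    rw [← Finset.sum_mul]
    ring
  have h2 : ∀ x, (p x * mean fun z : W → Bool => F (swapOn z x)) =
      mean fun z : W → Bool => p x * F (swapOn z x) := by
    intro x
    simp only [mean]
    rw [← Finset.mul_sum]
    ring
  simp only [h1, h2, sum_mean_comm]
  congr 1
  funext z
  rw [← Equiv.sum_comp (swapPerm z)]
  refine Finset.sum_congr rfl fun x _ => ?_
  rw [swapPerm_apply, swapOn_swapOn]
  simp [swapOn_false]

theorem mean_bif_coin {W : Type*} [Fintype W] [DecidableEq W] (i : W) (a b : ℝ) :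
    mean (fun z : W → Bool => bif z i then a else b) = (a + b) / 2 := by
  have hinv : Function.Involutive
      (fun (z : W → Bool) (j : W) => xor (z j) (decide (j = i))) := by
    intro z; funext j; simp
  set e : Equiv.Perm (W → Bool) := hinv.toPerm with he
  have h1 := mean_comp_equiv e fun z : W → Bool => bif z i then a else b
  have h2 := mean_add (fun z : W → Bool => bif z i then a else b)
    fun z => bif e z i then a else b
  have h3 : (fun z : W → Bool => (bif z i then a else b) +
      bif e z i then a else b) = fun _ => a + b := by
    funext z
    cases h : z i <;> simp [he, h, add_comm]
  rw [h3, h1, mean_const] at h2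
  linarith

theorem sum_butterfly {d : ℕ} (q : (Cube d → C) → ℝ) : ∑ f, butterfly d q f = ∑ f, q f := by
  induction d with
  | zero => rfl
  | succ d ih =>
    have h := sum_coinSwap_mul (onLeft (butterfly d) (onRight (butterfly d)
      fun x => q ((halves d C).symm x))) fun _ => 1
    simp only [mul_one, mean_const] at h
    change ∑ f, coinSwap _ (halves d C f) = _
    rw [Equiv.sum_comp, h, Fintype.sum_prod_type_right]
    simp only [onLeft, ih]
    rw [Finset.sum_comm]
    simp only [onRight, ih]
    rw [← Equiv.sum_comp (halves d C).symm, Fintype.sum_prod_type]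

/-- The label at a given position is that of a uniformly random initial position. -/
theorem sum_butterfly_mul {d : ℕ} (q : (Cube d → C) → ℝ) (u : Cube d) (φ : C → ℝ) :
    ∑ f, butterfly d q f * φ (f u) = ∑ f, q f * ((∑ v, φ (f v)) / 2 ^ d) := by
  induction d with
  | zero =>
    refine Finset.sum_congr rfl fun f _ => ?_
    have : (∑ v, φ (f v)) = φ (f u) := Fintype.sum_subsingleton _ u
    rw [this, pow_zero, div_one, butterfly]
  | succ d ih =>
    set p : (Cube d → C) × (Cube d → C) → ℝ := fun x => q ((halves d C).symm x) with hp
    set y : Cube d := Fin.tail u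
    have hu : Fin.cons (u 0) y = u := Fin.cons_self_tail u
    change ∑ f, coinSwap (onLeft (butterfly d) (onRight (butterfly d) p)) (halves d C f) * _ = _
    have e1 : ∀ f : Cube (d + 1) → C, φ (f u) =
        (fun x : (Cube d → C) × (Cube d → C) => φ (bif u 0 then x.2 y else x.1 y))
          (halves d C f) := by
      intro f
      conv_lhs => rw [← hu]
      simp only [halves, Equiv.coe_fn_mk]
      cases u 0 <;> rfl
    simp only [e1]
    rw [Equiv.sum_comp (halves d C) fun x => coinSwap (onLeft (butterfly d)
      (onRight (butterfly d) p)) x * φ (bif u 0 then x.2 y else x.1 y), sum_coinSwap_mul]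
    have e2 : ∀ x : (Cube d → C) × (Cube d → C), (mean fun z : Cube d → Bool =>
        φ (bif u 0 then (swapOn z x).2 y else (swapOn z x).1 y)) =
        (φ (x.1 y) + φ (x.2 y)) / 2 := by
      intro x
      have : ∀ z : Cube d → Bool, φ (bif u 0 then (swapOn z x).2 y else (swapOn z x).1 y) =
          bif z y then (bif u 0 then φ (x.1 y) else φ (x.2 y))
            else (bif u 0 then φ (x.2 y) else φ (x.1 y)) := by
        intro z
        simp only [swapOn]
        cases u 0 <;> cases z y <;> rfl
      simp only [this, mean_bif_coin]
      cases u 0 <;> simp [add_comm]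
    simp only [e2]
    have hL : ∑ x, onLeft (butterfly d) (onRight (butterfly d) p) x * φ (x.1 y) =
        ∑ x, p x * ((∑ v, φ (x.1 v)) / 2 ^ d) := by
      rw [Fintype.sum_prod_type_right]
      simp only [onLeft, ih]
      rw [Finset.sum_comm, Fintype.sum_prod_type]
      refine Finset.sum_congr rfl fun l _ => ?_
      simp only [← Finset.sum_mul]
      congr 1
      simp only [onRight, sum_butterfly]
    have hR : ∑ x, onLeft (butterfly d) (onRight (butterfly d) p) x * φ (x.2 y) =
        ∑ x, p x * ((∑ v, φ (x.2 v)) / 2 ^ d) := by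
      rw [Fintype.sum_prod_type_right]
      simp only [onLeft, ← Finset.sum_mul, sum_butterfly]
      simp only [Finset.sum_mul]
      rw [Finset.sum_comm, Fintype.sum_prod_type]
      refine Finset.sum_congr rfl fun l _ => ?_
      simp only [onRight, ih]
    have e3 : ∀ x : (Cube d → C) × (Cube d → C),
        onLeft (butterfly d) (onRight (butterfly d) p) x * ((φ (x.1 y) + φ (x.2 y)) / 2) =
        onLeft (butterfly d) (onRight (butterfly d) p) x * φ (x.1 y) / 2 +
        onLeft (butterfly d) (onRight (butterfly d) p) x * φ (x.2 y) / 2 := fun x => by ring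
    simp only [e3]
    rw [Finset.sum_add_distrib, ← Finset.sum_div, ← Finset.sum_div, hL, hR, Finset.sum_div,
      Finset.sum_div, ← Finset.sum_add_distrib, ← Equiv.sum_comp (halves d C)]
    refine Finset.sum_congr rfl fun f _ => ?_
    rw [hp, sum_cube_succ]
    simp only [Equiv.symm_apply_apply]
    simp only [halves, Equiv.coe_fn_mk]
    rw [pow_succ]
    ring

end

/-! ### Entropy lost by the exchanges between the halves. -/

/-- Precomposition with a bijection of the positions. -/
def relabel {V W : Type*} (C : Type*) (e : V ≃ W) : (W → C) ≃ (V → C) where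
  toFun f := f ∘ e
  invFun f := f ∘ e.symm
  left_inv f := by funext i; simp
  right_inv f := by funext i; simp

theorem coinSwap_relabel {V W C : Type*} [Fintype V] [DecidableEq V] [Fintype W] [DecidableEq W]
    (e : V ≃ W) (p : (W → C) × (W → C) → ℝ) (x : (V → C) × (V → C)) :
    coinSwap (fun x : (V → C) × (V → C) => p (x.1 ∘ e.symm, x.2 ∘ e.symm)) x =
      coinSwap p (x.1 ∘ e.symm, x.2 ∘ e.symm) := by
  simp only [coinSwap]
  rw [← mean_comp_equiv (relabel Bool e)]
  congr 1
  funext z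
  congr 2 <;> funext i <;> simp [swapOn, relabel]

/-- If, given the right half, every left label is uniform on the labels that the right half misses,
then a round of fair exchanges between the halves removes a `1 / (72 L)` fraction of the entropy of
the set of labels in the right half. -/
theorem coinSwap_entropy_drop {W C : Type*} [Fintype W] [DecidableEq W] [Fintype C]
    [DecidableEq C] {N : ℕ} (hW : Fintype.card W = N) {A : Finset C} (hA : A.card = N + N)
    {p : (W → C) × (W → C) → ℝ} (hp : ∀ x, 0 ≤ p x)
    (hsupp : ∀ l r, p (l, r) ≠ 0 → Function.Injective r ∧ ∀ i, r i ∈ A)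
    (hunif : ∀ (r : W → C) (y : W) (φ : C → ℝ), ∑ l, p (l, r) * φ (l y) =
      (∑ l, p (l, r)) * ((∑ b ∈ A with ∀ i, r i ≠ b, φ b) / N))
    {L : ℝ} (hL : 1 / 2 ≤ L) (hlog : Real.log (N + N : ℕ) ≤ L) :
    1 / (72 * L) * ∑ r, (∑ l, p (l, r)) *
      (Real.log (mean fun h : Equiv.Perm W => ∑ l, p (l, r ∘ h)) + Real.log (N + N).factorial -
        Real.log N.factorial - Real.log (∑ x, p x)) ≤
      sumMulLog p - sumMulLog (coinSwap p) := by
  have hM : N ≤ N + N := by omega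
  set pR : (W → C) → ℝ := fun r => ∑ l, p (l, r) with hpR
  have hpR0 : ∀ r, 0 ≤ pR r := fun r => Finset.sum_nonneg fun l _ => hp _
  have hpRs : ∀ r, pR r ≠ 0 → Function.Injective r ∧ ∀ i, r i ∈ A := by
    intro r hr
    obtain ⟨l, -, hl⟩ := Finset.exists_ne_zero_of_sum_ne_zero hr
    exact hsupp l r hl
  obtain ⟨e₀⟩ : Nonempty (Fin N ≃ W) := ⟨(Fintype.equivFinOfCardEq hW).symm⟩
  have : Nonempty (Fin N ≃ W) := ⟨e₀⟩
  -- Averaging over all enumerations of the positions makes the law exchangeable, as `sum_test_ge`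
  -- requires.
  set τ : (Fin N → C) → ℝ := fun s => mean fun e : Fin N ≃ W => pR (s ∘ e.symm) with hτdef
  have hτ : ∀ s, 0 ≤ τ s := fun s => mean_nonneg fun e => hpR0 _
  have hτs : ∀ s, τ s ≠ 0 → Function.Injective s ∧ ∀ i, s i ∈ A := by
    intro s hs
    obtain ⟨e, he⟩ := exists_ne_zero_of_mean_ne_zero hs
    obtain ⟨h1, h2⟩ := hpRs _ he
    refine ⟨fun i j hij => ?_, fun i => by simpa using h2 (e i)⟩
    have := @h1 (e i) (e j) (by simpa using hij)
    exact e.injective this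
  have hτsymm : ∀ (h : Equiv.Perm (Fin N)) s, τ (s ∘ h) = τ s := by
    intro h s
    simp only [hτdef]
    rw [← mean_comp_equiv (Equiv.equivCongr h.symm (Equiv.refl W))]
    congr 1
    funext e
    congr 1
    funext i
    simp [Equiv.equivCongr]
  have hτrel : ∀ (e : Fin N ≃ W) r, τ (r ∘ e) = mean fun h : Equiv.Perm W => pR (r ∘ h) := by
    intro e r
    simp only [hτdef]
    rw [← mean_comp_equiv (Equiv.equivCongr (Equiv.refl (Fin N)) (Equiv.refl W) |>.trans
      (Equiv.equivCongr e (Equiv.refl W)) |>.trans (Equiv.symmEquiv W W))]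
    congr 1
  have hτsum : ∀ F : (Fin N → C) → ℝ, ∑ s, τ s * F s =
      mean fun e : Fin N ≃ W => ∑ r, pR r * F (r ∘ e) := by
    intro F
    have h1 : ∀ s, τ s * F s = mean fun e : Fin N ≃ W => pR (s ∘ e.symm) * F s := by
      intro s
      simp only [hτdef, mean]
      rw [← Finset.sum_mul]
      ring
    simp only [h1, sum_mean_comm]
    congr 1
    funext e
    rw [← Equiv.sum_comp (relabel C e)]
    refine Finset.sum_congr rfl fun r _ => ?_
    change pR ((relabel C e).symm (relabel C e r)) * _ = _
    rw [Equiv.symm_apply_apply]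
    rfl
  set g : Fin N → (Fin N → C) → ℝ := fun k s =>
    2 * stepDensity (N + N) τ k s / (1 + stepDensity (N + N) τ k s) with hgdef
  have ht0 : ∀ k s, 0 ≤ stepDensity (N + N) τ k s := fun k s => stepDensity_nonneg hτ hM k s
  set H : Fin N → (Fin N → C) → ℝ := fun k s => Real.log (g k s) + 1 - g k s / 2 -
        (∑ b ∈ A with ∀ i, s i ≠ b, g k (Function.update s k b)) / N / 2 with hHdef
  -- The entropy drop does not depend on the enumeration. The tests, built from `τ`, are the same
  -- for every `e`, and the lower bound is linear in the law of the right half, so it can be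
  -- averaged over `e`.
  have hdrop : ∀ e : Fin N ≃ W, ∑ k, ∑ r, pR r * H k (r ∘ e) ≤
      sumMulLog p - sumMulLog (coinSwap p) := by
    intro e
    set pe : (Fin N → C) × (Fin N → C) → ℝ :=
      fun x => p (x.1 ∘ e.symm, x.2 ∘ e.symm) with hpe
    have hmarg : ∀ (s : Fin N → C) (F : (W → C) → ℝ),
        ∑ l, pe (l, s) * F (l ∘ e.symm) = ∑ l, p (l, s ∘ e.symm) * F l := fun s F =>
      Equiv.sum_comp (relabel C e.symm) fun l => p (l, s ∘ e.symm) * F l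
    have hmarg1 : ∀ s : Fin N → C, ∑ l, pe (l, s) = pR (s ∘ e.symm) := by
      intro s
      simpa using hmarg s fun _ => 1
    have h := sum_right_test_le (A := A) (p := pe) (fun x => hp _) (by
      intro s k φ
      have h1 := hmarg s fun l => φ (l (e k))
      simp only [Function.comp_apply, Equiv.symm_apply_apply] at h1
      rw [h1, hunif, hmarg1]
      congr 3
      ext b
      simp only [Finset.mem_filter, Function.comp_apply]
      refine and_congr_right fun _ => ⟨fun h i => by simpa using h (e i), fun h i => h _⟩)
      g (fun k s => div_nonneg (by linarith [ht0 k s]) (by linarith [ht0 k s]))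
      (fun k s s' hs => by simp only [hgdef, stepDensity_congr hs])
      (by
        intro k x hx
        have hpos : 0 < τ x.2 := by
          have h1 : 0 < pR (x.2 ∘ e.symm) :=
            hx.trans_le (Finset.single_le_sum (f := fun l => p (l, x.2 ∘ e.symm))
              (fun l _ => hp _) (Finset.mem_univ (x.1 ∘ e.symm)))
          refine div_pos (h1.trans_le ?_) (by exact_mod_cast Fintype.card_pos)
          exact Finset.single_le_sum (f := fun e : Fin N ≃ W => pR (x.2 ∘ e.symm))
            (fun e _ => hpR0 _) (Finset.mem_univ e)
        have := stepDensity_pos hτ hM k hpos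
        exact div_pos (by linarith) (by linarith))
    have e1 : sumMulLog pe = sumMulLog p :=
      sumMulLog_comp_equiv ((relabel C e.symm).prodCongr (relabel C e.symm)) p
    have e2 : sumMulLog (coinSwap pe) = sumMulLog (coinSwap p) := by
      rw [← sumMulLog_comp_equiv ((relabel C e.symm).prodCongr (relabel C e.symm)) (coinSwap p)]
      congr 1
      funext x
      exact coinSwap_relabel e p x
    rw [e1, e2] at h
    refine le_trans (le_of_eq ?_) h
    refine Finset.sum_congr rfl fun k _ => ?_
    rw [← Equiv.sum_comp (relabel C e)]
    refine Finset.sum_congr rfl fun r _ => ?_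
    rw [hmarg1]
    change _ = pR ((relabel C e).symm (relabel C e r)) * _
    rw [Equiv.symm_apply_apply]
    rfl
  have hmean : ∑ k, ∑ s, τ s * H k s ≤ sumMulLog p - sumMulLog (coinSwap p) := by
    simp only [hτsum, sum_mean_comm (fun k (e : Fin N ≃ W) => ∑ r, pR r * H k (r ∘ e))]
    rw [mean, div_le_iff₀ (by exact_mod_cast Fintype.card_pos)]
    calc _ ≤ ∑ _e : Fin N ≃ W, (sumMulLog p - sumMulLog (coinSwap p)) :=
          Finset.sum_le_sum fun e _ => hdrop e
      _ = _ := by rw [Finset.sum_const, Finset.card_univ, nsmul_eq_mul, mul_comm]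
  refine le_trans ?_ ((Finset.sum_le_sum fun k _ =>
    sum_test_ge hτ hτs hA hτsymm hL hlog k (g k) fun r => rfl).trans hmean)
  rw [← Finset.mul_sum]
  refine le_of_eq ?_
  congr 1
  have hw : ∑ s, τ s = ∑ x, p x := by
    have := hτsum fun _ => 1
    simp only [mul_one, mean_const] at this
    rw [this, Fintype.sum_prod_type_right]
  rw [Finset.sum_comm]
  have h1 : ∀ s, ∑ k, τ s * Real.log (stepDensity (N + N) τ k s) = τ s *
      (Real.log (τ s) + Real.log (N + N).factorial - Real.log N.factorial -
        Real.log (∑ x, p x)) := by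
    intro s
    rw [← Finset.mul_sum]
    rcases (hτ s).eq_or_lt with h | h
    · rw [← h, zero_mul, zero_mul]
    · rw [sum_log_stepDensity hτ hM h, hw, Nat.add_sub_cancel]
  rw [Finset.sum_congr rfl fun s _ => h1 s, hτsum]
  simp only [hτrel, mean_const]
  rfl

/-! ### Chain rule and induction on the dimension. -/

/-- The law `q` lives on injective labellings with labels in `A`. -/
def InjectiveOn {W C : Type*} (A : Finset C) (q : (W → C) → ℝ) : Prop :=
  ∀ f, q f ≠ 0 → Function.Injective f ∧ ∀ u, f u ∈ A

/-- All points of `X` lie in one orbit, hence share one denominator, which counts each of them at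
least once. -/
theorem sum_div_sum_orbit_le_one {W C : Type*} [Fintype W] [DecidableEq W] [DecidableEq C]
    (X : Finset (W → C))
    (hX : ∀ r ∈ X, ∀ r' ∈ X, ∃ h : Equiv.Perm W, r' = r ∘ h) {f : (W → C) → ℝ}
    (hf : ∀ r, 0 ≤ f r) :
    ∑ r ∈ X, f r / ∑ h : Equiv.Perm W, f (r ∘ h) ≤ 1 := by
  rcases X.eq_empty_or_nonempty with rfl | ⟨r₀, hr₀⟩
  · simp
  have hZ : ∀ r ∈ X, ∑ h : Equiv.Perm W, f (r ∘ h) = ∑ h : Equiv.Perm W, f (r₀ ∘ h) := by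
    intro r hr
    obtain ⟨h₀, rfl⟩ := hX r₀ hr₀ r hr
    rw [← Equiv.sum_comp (Equiv.mulLeft h₀) fun h : Equiv.Perm W => f (r₀ ∘ h)]
    rfl
  rw [Finset.sum_congr rfl fun r hr => by rw [hZ r hr], ← Finset.sum_div]
  refine div_le_one_of_le₀ ?_ (Finset.sum_nonneg fun h _ => hf _)
  classical
  have hsub : X ⊆ Finset.univ.image (fun h : Equiv.Perm W => r₀ ∘ h) := by
    intro r hr
    obtain ⟨h, rfl⟩ := hX r₀ hr₀ r hr
    exact Finset.mem_image_of_mem (fun h : Equiv.Perm W => r₀ ∘ h) (Finset.mem_univ h)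
  calc ∑ r ∈ X, f r ≤ ∑ r ∈ Finset.univ.image (fun h : Equiv.Perm W => r₀ ∘ h), f r :=
        Finset.sum_le_sum_of_subset_of_nonneg hsub fun r _ _ => hf r
    _ ≤ ∑ h : Equiv.Perm W, f (r₀ ∘ h) :=
        Finset.sum_image_le_of_nonneg fun r _ => hf r

theorem exists_perm_of_range_eq {W C : Type*} {r r' : W → C} (hr : Function.Injective r)
    (hr' : Function.Injective r') (h : Set.range r = Set.range r') :
    ∃ e : Equiv.Perm W, r' = r ∘ e := by
  refine ⟨(Equiv.ofInjective r' hr').trans ((Equiv.setCongr h.symm).trans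
    (Equiv.ofInjective r hr).symm), ?_⟩
  funext i
  have := Equiv.apply_ofInjective_symm hr (Equiv.setCongr h.symm (Equiv.ofInjective r' hr' i))
  exact this.symm

theorem sum_prod_fst_mul {X Y : Type*} [Fintype X] [Fintype Y] {p : X × Y → ℝ} {pL : X → ℝ}
    (hL : ∀ l, ∑ r, p (l, r) = pL l) (F : X → ℝ) : ∑ x, p x * F x.1 = ∑ l, pL l * F l := by
  rw [Fintype.sum_prod_type]
  refine Finset.sum_congr rfl fun l _ => ?_
  rw [← hL, Finset.sum_mul]

theorem sum_prod_snd_mul {X Y : Type*} [Fintype X] [Fintype Y] {p : X × Y → ℝ} {pR : Y → ℝ}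
    (hR : ∀ r, ∑ l, p (l, r) = pR r) (F : Y → ℝ) : ∑ x, p x * F x.2 = ∑ r, pR r * F r := by
  rw [Fintype.sum_prod_type_right]
  refine Finset.sum_congr rfl fun r _ => ?_
  rw [← hR, Finset.sum_mul]

/-- Chain rule for two laws `p`, `p₁` with the same first marginal. -/
theorem two_stage_chain_rule {X Y : Type*} [Fintype X] [Fintype Y] {p p₁ : X × Y → ℝ}
    {pL : X → ℝ} {pR Z : Y → ℝ} {w : ℝ} (hL : ∀ l, ∑ r, p (l, r) = pL l)
    (hL₁ : ∀ l, ∑ r, p₁ (l, r) = pL l) (hw : ∑ x, p x = w) (hw₁ : ∑ x, p₁ x = w) (a b : ℝ) :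
    ∑ x, p x * (Real.log (p x) + b - Real.log w) + ∑ x, p₁ x * (Real.log (p₁ x) +
      Real.log (Z x.2) - Real.log (pL x.1) - Real.log (pR x.2)) =
    ∑ x, p x * (Real.log (p x) + a - Real.log (pL x.1)) +
      ∑ x, p₁ x * (Real.log (p₁ x) + a - Real.log (pR x.2)) +
      ∑ x, p₁ x * (Real.log (Z x.2) + b - 2 * a - Real.log w) := by
  -- Mixing the right half keeps the left marginal, so the two terms in `pL` cancel.
  have h1 : ∑ x, p x * Real.log (pL x.1) = ∑ x, p₁ x * Real.log (pL x.1) :=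
    (sum_prod_fst_mul hL fun l => Real.log (pL l)).trans
      (sum_prod_fst_mul hL₁ fun l => Real.log (pL l)).symm
  simp only [mul_add, mul_sub, Finset.sum_add_distrib, Finset.sum_sub_distrib, ← Finset.sum_mul,
    hw, hw₁, h1]
  ring

/-- Given the first coordinate, the second one has at least as much entropy relative to its orbit
as it has unconditionally. -/
theorem sum_conditional_log_nonneg {X W C : Type*} [Fintype X] [Fintype W] [DecidableEq W]
    [Fintype C] [DecidableEq C] {p : X × (W → C) → ℝ} (hp : ∀ x, 0 ≤ p x) {pL : X → ℝ}
    {pR Z : (W → C) → ℝ} (hL : ∀ l, ∑ r, p (l, r) = pL l) (hR : ∀ r, ∑ l, p (l, r) = pR r)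
    (hZ : ∀ r, Z r = ∑ h : Equiv.Perm W, pR (r ∘ h))
    (horbit : ∀ l r r', p (l, r) ≠ 0 → p (l, r') ≠ 0 → ∃ h : Equiv.Perm W, r' = r ∘ h) :
    0 ≤ ∑ x, p x * (Real.log (p x) + Real.log (Z x.2) - Real.log (pL x.1) -
      Real.log (pR x.2)) := by
  have hR0 : ∀ r, 0 ≤ pR r := fun r => by
    rw [← hR]; exact Finset.sum_nonneg fun l _ => hp _
  have hL0 : ∀ l, 0 ≤ pL l := fun l => by
    rw [← hL]; exact Finset.sum_nonneg fun l _ => hp _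
  have hpos : ∀ x, 0 < p x → 0 < pL x.1 ∧ 0 < pR x.2 ∧ 0 < Z x.2 := by
    intro x hx
    have h2 : 0 < pR x.2 := by
      rw [← hR]
      exact hx.trans_le (Finset.single_le_sum (f := fun l => p (l, x.2)) (fun l _ => hp _)
        (Finset.mem_univ x.1))
    refine ⟨?_, h2, ?_⟩
    · rw [← hL]
      exact hx.trans_le (Finset.single_le_sum (f := fun r => p (x.1, r)) (fun l _ => hp _)
        (Finset.mem_univ x.2))
    · rw [hZ]
      exact h2.trans_le (Finset.single_le_sum (f := fun h : Equiv.Perm W => pR (x.2 ∘ h))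
        (fun h _ => hR0 _) (Finset.mem_univ 1))
  -- Gibbs with test 1 against the law that draws `l` from `pL` and then `r` from `pR` conditioned
  -- on its orbit, cut to the support of `p`; there `l` determines the orbit.
  have h1 : ∀ x, p x - (if p x ≠ 0 then pL x.1 * (pR x.2 / Z x.2) else 0) ≤
      p x * (Real.log (p x) + Real.log (Z x.2) - Real.log (pL x.1) - Real.log (pR x.2)) := by
    intro x
    rcases (hp x).eq_or_lt with h | h
    · simp [← h]
    obtain ⟨a, b, c⟩ := hpos x h
    rw [if_pos h.ne']
    have := mul_log_sub_log_ge (p := p x) (m := pL x.1 * (pR x.2 / Z x.2)) (g := 1) h.le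
      (by positivity) zero_le_one (fun _ => by positivity) (fun _ => one_pos)
    rw [Real.log_one, mul_zero, zero_add, mul_one, Real.log_mul a.ne' (by positivity),
      Real.log_div b.ne' c.ne'] at this
    linarith
  refine le_trans ?_ (Finset.sum_le_sum fun x _ => h1 x)
  rw [Finset.sum_sub_distrib, sub_nonneg, Fintype.sum_prod_type, Fintype.sum_prod_type]
  refine Finset.sum_le_sum fun l _ => ?_
  rw [← Finset.sum_filter]
  change ∑ r with p (l, r) ≠ 0, pL l * (pR r / Z r) ≤ _
  rw [← Finset.mul_sum, hL]
  refine mul_le_of_le_one_right (hL0 l) ?_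
  simp only [hZ]
  exact sum_div_sum_orbit_le_one _ (fun r hr r' hr' => horbit l r r' (Finset.mem_filter.1 hr).2
    (Finset.mem_filter.1 hr').2) hR0

section
variable {C : Type*} [Fintype C] [DecidableEq C]

-- Equality of the sums for all `φ` says that the two labellings have the same multiset of labels.
-- An indicator at a repeated label, and the indicator of the complement of `A`, then give the two
-- claims.
omit [Fintype C] [DecidableEq C] in
theorem InjectiveOn.of_sum_eq {W : Type*} [Fintype W] {A : Finset C} {q q' : (W → C) → ℝ}
    (hq : InjectiveOn A q)
    (h : ∀ f, q' f ≠ 0 → ∃ f', q f' ≠ 0 ∧ ∀ φ : C → ℝ, ∑ u, φ (f u) = ∑ u, φ (f' u)) :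
    InjectiveOn A q' := by
  classical
  intro f hf
  obtain ⟨f', hf', hφ⟩ := h f hf
  obtain ⟨hinj, hmem⟩ := hq f' hf'
  constructor
  · intro i j hij
    by_contra hne
    have h1 := hφ fun c => if c = f i then 1 else 0
    have h2 : ∑ u, (if f' u = f i then (1 : ℝ) else 0) ≤ 1 := by
      rw [Finset.sum_boole]
      have : (Finset.univ.filter fun u => f' u = f i).card ≤ 1 :=
        Finset.card_le_one.2 fun a ha b hb => hinj
          ((Finset.mem_filter.1 ha).2.trans (Finset.mem_filter.1 hb).2.symm)
      exact_mod_cast this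
    have h3 : (2 : ℝ) ≤ ∑ u, (if f u = f i then (1 : ℝ) else 0) := by
      calc (2 : ℝ) = ∑ u ∈ ({i, j} : Finset W), (if f u = f i then (1 : ℝ) else 0) := by
            rw [Finset.sum_pair hne]; simp [hij]; norm_num
        _ ≤ _ := Finset.sum_le_sum_of_subset_of_nonneg (Finset.subset_univ _)
            fun _ _ _ => by split_ifs <;> norm_num
    linarith
  · intro u
    by_contra hu
    have h1 := hφ fun c => if c ∈ A then 0 else 1
    have h2 : ∑ u, (if f' u ∈ A then (0 : ℝ) else 1) = 0 :=
      Finset.sum_eq_zero fun v _ => if_pos (hmem v)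
    have h3 := Finset.single_le_sum (f := fun u => if f u ∈ A then (0 : ℝ) else 1)
      (fun _ _ => by split_ifs <;> norm_num) (Finset.mem_univ u)
    simp only [if_neg hu] at h3
    linarith

set_option maxHeartbeats 400000 in
/-- The butterfly network on `2 ^ d` positions removes a `1 / (72 L)` fraction of the relative
entropy as soon as `d log 2 ≤ L`. -/
theorem butterfly_entropy_drop {L : ℝ} (hL : 1 / 2 ≤ L) (d : ℕ)
    (hlog : Real.log (2 ^ d : ℕ) ≤ L) (A : Finset C) (hA : A.card = 2 ^ d)
    (q : (Cube d → C) → ℝ) (hq : ∀ f, 0 ≤ q f) (hqA : InjectiveOn A q) :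
    1 / (72 * L) * ∑ f, q f * (Real.log (q f) + Real.log (2 ^ d).factorial -
      Real.log (∑ f, q f)) ≤ sumMulLog q - sumMulLog (butterfly d q) := by
  -- `L` stays fixed, so every level has the same fraction. `A` varies because a conditional law of
  -- one half uses the labels missed by the other; such laws are left unnormalised.
  induction d generalizing A with
  | zero =>
    obtain ⟨a, rfl⟩ := Finset.card_eq_one.1 hA
    have h1 : ∀ f, q f ≠ 0 → f = fun _ => a := fun f hf =>
      funext fun u => Finset.mem_singleton.1 ((hqA f hf).2 u)
    have h2 : ∑ f, q f = q fun _ => a :=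
      Finset.sum_eq_single _ (fun f _ hf => by_contra fun h => hf (h1 f h)) (by simp)
    have h3 : ∑ f, q f * (Real.log (q f) + Real.log (2 ^ 0).factorial -
        Real.log (∑ f, q f)) = 0 := by
      refine Finset.sum_eq_zero fun f _ => ?_
      by_cases hf : q f = 0
      · simp [hf]
      · rw [h2, h1 f hf]; simp
    rw [h3]
    simp [butterfly]
  | succ d ih =>
    set N := 2 ^ d with hNdef
    have hNN : 2 ^ (d + 1) = N + N := by rw [pow_succ, mul_two]
    have hNpos : 0 < N := by positivity
    rw [hNN] at hA hlog ⊢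
    have hlog' : Real.log (N : ℕ) ≤ L := by
      refine le_trans (Real.log_le_log (by exact_mod_cast hNpos) ?_) hlog
      exact_mod_cast Nat.le_add_right N N
    set κ := 1 / (72 * L) with hκ
    have hκ0 : 0 ≤ κ := by rw [hκ]; apply div_nonneg <;> linarith
    set p : (Cube d → C) × (Cube d → C) → ℝ := fun x => q ((halves d C).symm x) with hp
    set p1 := onRight (butterfly d) p with hp1
    set p2 := onLeft (butterfly d) p1 with hp2
    have hp0 : ∀ x, 0 ≤ p x := fun x => hq _
    have hp10 : ∀ x, 0 ≤ p1 x := fun x => butterfly_nonneg (fun r => hp0 _) _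
    have hp20 : ∀ x, 0 ≤ p2 x := fun x => butterfly_nonneg (fun r => hp10 _) _
    have hcardW : Fintype.card (Cube d) = N := by simp [Cube, hNdef]
    -- supports
    set Good : (Cube d → C) → (Cube d → C) → Prop := fun l r =>
      InjectiveOn A (fun f => if f = (halves d C).symm (l, r) then 1 else 0) with hGood
    have hgood : ∀ l r, Good l r → Function.Injective l ∧ Function.Injective r ∧
        (∀ i, l i ∈ A) ∧ (∀ i, r i ∈ A) ∧ ∀ i j, l i ≠ r j := by
      intro l r h
      obtain ⟨hinj, hmem⟩ := h ((halves d C).symm (l, r)) (by simp)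
      have hl : ∀ y, (halves d C).symm (l, r) (Fin.cons false y) = l y := fun y => by
        simp [halves]
      have hr : ∀ y, (halves d C).symm (l, r) (Fin.cons true y) = r y := fun y => by
        simp [halves]
      refine ⟨fun i j hij => ?_, fun i j hij => ?_, fun i => hl i ▸ hmem _,
        fun i => hr i ▸ hmem _, fun i j hij => ?_⟩
      · rw [← hl, ← hl] at hij
        exact (Fin.cons_inj.1 (hinj hij)).2
      · rw [← hr, ← hr] at hij
        exact (Fin.cons_inj.1 (hinj hij)).2
      · rw [← hl, ← hr] at hij
        exact absurd (Fin.cons_inj.1 (hinj hij)).1 (by simp)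
    have hgp : ∀ l r, p (l, r) ≠ 0 → Good l r := by
      intro l r h f hf
      have : f = (halves d C).symm (l, r) := by by_contra h'; simp [h'] at hf
      rw [this]
      exact hqA _ h
    have hsum : ∀ l r (φ : C → ℝ), ∑ u, φ ((halves d C).symm (l, r) u) =
        ∑ y, φ (l y) + ∑ y, φ (r y) := by
      intro l r φ
      rw [sum_cube_succ]
      simp [halves]
    -- Stating `Good` through a point mass lets `InjectiveOn.of_sum_eq` carry it along equal
    -- multisets of labels.
    have hgood_of : ∀ l r l' r', Good l' r' → (∀ φ : C → ℝ, ∑ y, φ (l y) + ∑ y, φ (r y) =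
        ∑ y, φ (l' y) + ∑ y, φ (r' y)) → Good l r := by
      intro l r l' r' h' hφ
      refine h'.of_sum_eq fun f hf => ⟨(halves d C).symm (l', r'), by simp, fun φ => ?_⟩
      have : f = (halves d C).symm (l, r) := by by_contra h'; simp [h'] at hf
      rw [this, hsum, hsum, hφ]
    have hgp1 : ∀ l r, p1 (l, r) ≠ 0 → Good l r := by
      intro l r h
      obtain ⟨r', hr', hφ⟩ := butterfly_support h
      exact hgood_of l r l r' (hgp _ _ hr') fun φ => by rw [hφ]
    have hgp2 : ∀ l r, p2 (l, r) ≠ 0 → Good l r := by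
      intro l r h
      obtain ⟨l', hl', hφ⟩ := butterfly_support h
      exact hgood_of l r l' r (hgp1 _ _ hl') fun φ => by rw [hφ]
    have hcardcompl : ∀ f : Cube d → C, Function.Injective f → (∀ i, f i ∈ A) →
        (A.filter fun b => ∀ i, f i ≠ b).card = N := by
      intro f hf hfA
      have e : (A.filter fun b => ∀ i, f i ≠ b) = A \ Finset.univ.image f := by
        ext b; simp
      rw [e, Finset.card_sdiff_of_subset, Finset.card_image_of_injective _ hf,
        Finset.card_univ, hcardW, hA, Nat.add_sub_cancel]
      intro b hb
      obtain ⟨i, -, rfl⟩ := Finset.mem_image.1 hb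
      exact hfA i
    -- A dummy label set for fibres of zero mass.
    obtain ⟨A₀, -, hA₀⟩ := Finset.exists_subset_card_eq (show N ≤ A.card by omega)
    -- the marginals
    set pL : (Cube d → C) → ℝ := fun l => ∑ r, p (l, r) with hpL
    set pR : (Cube d → C) → ℝ := fun r => ∑ l, p1 (l, r) with hpR
    have hp1L : ∀ l, ∑ r, p1 (l, r) = pL l := fun l => sum_butterfly fun r => p (l, r)
    have hp2R : ∀ r, ∑ l, p2 (l, r) = pR r := fun r => sum_butterfly fun l => p1 (l, r)
    set w := ∑ f, q f with hw
    have hwp : ∑ x, p x = w := Equiv.sum_comp (halves d C).symm q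
    have hwL : ∑ l, pL l = w := by rw [← hwp, Fintype.sum_prod_type]
    have hwp1 : ∑ x, p1 x = w := by
      rw [← hwL, Fintype.sum_prod_type]; exact Finset.sum_congr rfl fun l _ => hp1L l
    have hwR : ∑ r, pR r = w := by rw [← hwp1, Fintype.sum_prod_type_right]
    have hwp2 : ∑ x, p2 x = w := by
      rw [← hwR, Fintype.sum_prod_type_right]; exact Finset.sum_congr rfl fun r _ => hp2R r
    -- the three drops
    have drop1 : κ * ∑ x, p x * (Real.log (p x) + Real.log N.factorial - Real.log (pL x.1)) ≤
        sumMulLog p - sumMulLog p1 := by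
      simp only [sumMulLog, Fintype.sum_prod_type]
      rw [← Finset.sum_sub_distrib, Finset.mul_sum]
      refine Finset.sum_le_sum fun l _ => ?_
      by_cases h : ∃ r, p (l, r) ≠ 0
      · obtain ⟨r₀, hr₀⟩ := h
        obtain ⟨h1, -, h2, -, -⟩ := hgood _ _ (hgp _ _ hr₀)
        refine ih hlog' (A.filter fun b => ∀ i, l i ≠ b) (hcardcompl l h1 h2)
          (fun r => p (l, r)) (fun r => hp0 _) fun r hr => ?_
        obtain ⟨-, h3, -, h4, h5⟩ := hgood _ _ (hgp _ _ hr)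
        exact ⟨h3, fun u => Finset.mem_filter.2 ⟨h4 u, fun i => h5 i u⟩⟩
      · push Not at h
        exact ih hlog' A₀ hA₀ (fun r => p (l, r)) (fun r => hp0 _) fun r hr => absurd (h r) hr
    have drop2 : κ * ∑ x, p1 x * (Real.log (p1 x) + Real.log N.factorial - Real.log (pR x.2)) ≤
        sumMulLog p1 - sumMulLog p2 := by
      simp only [sumMulLog, Fintype.sum_prod_type_right]
      rw [← Finset.sum_sub_distrib, Finset.mul_sum]
      refine Finset.sum_le_sum fun r _ => ?_
      by_cases h : ∃ l, p1 (l, r) ≠ 0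
      · obtain ⟨l₀, hl₀⟩ := h
        obtain ⟨-, h1, -, h2, -⟩ := hgood _ _ (hgp1 _ _ hl₀)
        refine ih hlog' (A.filter fun b => ∀ i, r i ≠ b) (hcardcompl r h1 h2)
          (fun l => p1 (l, r)) (fun l => hp10 _) fun l hl => ?_
        obtain ⟨h3, -, h4, -, h5⟩ := hgood _ _ (hgp1 _ _ hl)
        exact ⟨h3, fun u => Finset.mem_filter.2 ⟨h4 u, fun i => (h5 u i).symm⟩⟩
      · push Not at h
        exact ih hlog' A₀ hA₀ (fun l => p1 (l, r)) (fun l => hp10 _) fun l hl => absurd (h l) hl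
    have drop3 := coinSwap_entropy_drop hcardW hA hp20
      (fun l r h => ⟨(hgood _ _ (hgp2 _ _ h)).2.1, (hgood _ _ (hgp2 _ _ h)).2.2.2.1⟩) (by
        intro r y φ
        rw [hp2R]
        -- The mixed left half has uniform one-point marginals on the labels of `l`, which are
        -- exactly those missed by `r`.
        have h1 := sum_butterfly_mul (fun l => p1 (l, r)) y φ
        change ∑ l, p2 (l, r) * φ (l y) = _ at h1
        rw [h1, hpR, Finset.sum_mul]
        refine Finset.sum_congr rfl fun l _ => ?_
        by_cases h0 : p1 (l, r) = 0
        · rw [h0, zero_mul, zero_mul]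
        obtain ⟨g1, g2, g3, g4, g5⟩ := hgood _ _ (hgp1 _ _ h0)
        have himg : Finset.univ.image l = A.filter fun b => ∀ i, r i ≠ b := by
          refine Finset.eq_of_subset_of_card_le ?_ ?_
          · intro b hb
            obtain ⟨i, -, rfl⟩ := Finset.mem_image.1 hb
            exact Finset.mem_filter.2 ⟨g3 i, fun j => (g5 i j).symm⟩
          · rw [hcardcompl r g2 g4, Finset.card_image_of_injective _ g1, Finset.card_univ, hcardW]
        rw [← himg, Finset.sum_image fun _ _ _ _ h => g1 h, hNdef]
        push_cast
        rfl) hL hlog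
    simp only [hp2R, hwp2] at drop3
    have e0 : sumMulLog p = sumMulLog q := sumMulLog_comp_equiv (halves d C).symm q
    have e3 : sumMulLog (butterfly (d + 1) q) = sumMulLog (coinSwap p2) :=
      sumMulLog_comp_equiv (halves d C) (coinSwap p2)
    -- the entropy of the right half given its set of labels
    set Z : (Cube d → C) → ℝ := fun r => ∑ h : Equiv.Perm (Cube d), pR (r ∘ h) with hZ
    have hmeanZ : ∀ r, (mean fun h : Equiv.Perm (Cube d) => pR (r ∘ h)) = Z r / N.factorial := by
      intro r
      rw [mean, Fintype.card_perm, hcardW]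
    have gibbs := sum_conditional_log_nonneg hp10 hp1L (fun r => rfl) (fun r => rfl) (by
      have hrange : ∀ l r, p1 (l, r) ≠ 0 → Function.Injective r ∧
          Set.range r = ↑(A.filter fun b => ∀ i, l i ≠ b) := by
        intro l r h0
        obtain ⟨g1, g2, g3, g4, g5⟩ := hgood _ _ (hgp1 _ _ h0)
        refine ⟨g2, ?_⟩
        have himg : Finset.univ.image r = A.filter fun b => ∀ i, l i ≠ b := by
          refine Finset.eq_of_subset_of_card_le ?_ ?_
          · intro b hb
            obtain ⟨i, -, rfl⟩ := Finset.mem_image.1 hb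
            exact Finset.mem_filter.2 ⟨g4 i, fun j => g5 j i⟩
          · rw [hcardcompl l g1 g3, Finset.card_image_of_injective _ g2, Finset.card_univ, hcardW]
        rw [← himg]; simp
      intro l r r' hr hr'
      obtain ⟨a1, a2⟩ := hrange l r hr
      obtain ⟨b1, b2⟩ := hrange l r' hr'
      exact exists_perm_of_range_eq a1 b1 (a2.trans b2.symm))
    have hfac : (0 : ℝ) < N.factorial := by exact_mod_cast N.factorial_pos
    have hpRZ : ∀ r, pR r ≠ 0 → Z r ≠ 0 := by
      intro r hr
      have hpR0 : ∀ r, 0 ≤ pR r := fun r => Finset.sum_nonneg fun l _ => hp10 _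
      have : pR r ≤ Z r := Finset.single_le_sum (f := fun h : Equiv.Perm (Cube d) => pR (r ∘ h))
        (fun h _ => hpR0 _) (Finset.mem_univ 1)
      exact (((hpR0 r).lt_of_ne' hr).trans_le this).ne'
    have s3 : ∑ r, pR r * (Real.log (mean fun h : Equiv.Perm (Cube d) => pR (r ∘ h)) +
        Real.log (N + N).factorial - Real.log N.factorial - Real.log w) =
        ∑ x, p1 x * (Real.log (Z x.2) + Real.log (N + N).factorial -
          2 * Real.log N.factorial - Real.log w) := by
      rw [sum_prod_snd_mul (pR := pR) (fun r => rfl) fun r => Real.log (Z r) +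
        Real.log (N + N).factorial - 2 * Real.log N.factorial - Real.log w]
      refine Finset.sum_congr rfl fun r _ => ?_
      by_cases h : pR r = 0
      · rw [h, zero_mul, zero_mul]
      · rw [hmeanZ, Real.log_div (hpRZ r h) hfac.ne']
        ring
    have sq : ∑ f, q f * (Real.log (q f) + Real.log (N + N).factorial - Real.log w) =
        ∑ x, p x * (Real.log (p x) + Real.log (N + N).factorial - Real.log w) :=
      (Equiv.sum_comp (halves d C).symm fun f =>
        q f * (Real.log (q f) + Real.log (N + N).factorial - Real.log w)).symm
    have chain := two_stage_chain_rule (p := p) (p₁ := p1) (pL := pL) (pR := pR) (Z := Z) (w := w)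
      (fun l => rfl) hp1L hwp hwp1 (Real.log N.factorial) (Real.log (N + N).factorial)
    rw [s3] at drop3
    rw [sq, e3, ← e0]
    -- Adding the nonnegative Gibbs term turns the entropy into the exact sum of the three terms
    -- handled by the drops.
    calc _ ≤ κ * (∑ x, p x * (Real.log (p x) + Real.log (N + N).factorial - Real.log w) +
          ∑ x, p1 x * (Real.log (p1 x) + Real.log (Z x.2) - Real.log (pL x.1) -
            Real.log (pR x.2))) :=
          mul_le_mul_of_nonneg_left (le_add_of_nonneg_right gibbs) hκ0
      _ ≤ _ := by
        rw [chain, mul_add, mul_add]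
        linarith

end

/-! ### The Thorp rounds as a butterfly network. -/

/-- Split a labelling of the cube by the bit at `p`. -/
def splitAt {m : ℕ} (C : Type*) (p : Fin (m + 1)) :
    (Cube (m + 1) → C) ≃ (Cube m → C) × (Cube m → C) where
  toFun f := (fun y => f (p.insertNth false y), fun y => f (p.insertNth true y))
  invFun x u := bif u p then x.2 (p.removeNth u) else x.1 (p.removeNth u)
  left_inv f := by
    funext u
    have hu := p.insertNth_self_removeNth u
    cases h : u p <;> rw [h] at hu
    · simpa [h] using congrArg f hu
    · simpa [h] using congrArg f hu
  right_inv x := by simp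

theorem splitAt_zero (m : ℕ) (C : Type*) : splitAt C (0 : Fin (m + 1)) = halves m C := by
  ext f : 1
  simp [splitAt, halves]

/-- The action of one round of the reverse Thorp shuffle on laws of labellings. -/
noncomputable def thorpStep {m : ℕ} {C : Type*} (q : (Cube (m + 1) → C) → ℝ)
    (f : Cube (m + 1) → C) : ℝ :=
  mean fun z : Cube m → Bool => q (f ∘ rtStep z)

theorem rtStep_apply {m : ℕ} (z : Cube m → Bool) (x : Cube (m + 1)) :
    rtStep z x = (Fin.cons (xor (x (Fin.last m)) (z (Fin.init x))) (Fin.init x) :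
      Cube (m + 1)) := rfl

/-- A bit that is not last moves one place right unchanged; the others undergo a round in one
dimension less, with the coins selected by that bit. -/
theorem rtStep_insertNth {m : ℕ} (z : Cube (m + 1) → Bool) (p : Fin (m + 1)) (b : Bool)
    (y : Cube (m + 1)) :
    rtStep z (p.castSucc.insertNth b y : Cube (m + 2)) =
      (p.succ.insertNth b (rtStep (fun v => z (p.insertNth b v)) y) : Cube (m + 2)) := by
  have hinit : (Fin.init (p.castSucc.insertNth b y : Cube (m + 2)) : Cube (m + 1)) =
      p.insertNth b (Fin.init y) := by
    rw [Fin.eq_insertNth_iff]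
    constructor
    · simp [Fin.init]
    · funext j
      simp only [Fin.removeNth, Fin.init]
      rw [← Fin.castSucc_succAbove_castSucc, Fin.insertNth_apply_succAbove]
  have hlast : (p.castSucc.insertNth b y : Cube (m + 2)) (Fin.last (m + 1)) =
      y (Fin.last m) := by
    have := Fin.insertNth_apply_succAbove (α := fun _ => Bool) p.castSucc b y (Fin.last m)
    rwa [Fin.succAbove_castSucc_of_le _ _ (Fin.le_last p), Fin.succ_last] at this
  rw [Fin.eq_insertNth_iff]
  constructor
  · rw [rtStep_apply, Fin.cons_succ, hinit, Fin.insertNth_apply_same]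
  · funext j
    rw [Fin.removeNth, rtStep_apply, rtStep_apply]
    refine Fin.cases ?_ (fun j => ?_) j
    · rw [Fin.succ_succAbove_zero, Fin.cons_zero, Fin.cons_zero, hlast, hinit]
    · rw [Fin.succ_succAbove_succ, Fin.cons_succ, Fin.cons_succ, hinit,
        Fin.insertNth_apply_succAbove]

theorem rtStep_insertNth_last {m : ℕ} (z : Cube m → Bool) (b : Bool) (y : Cube m) :
    rtStep z ((Fin.last m).insertNth b y : Cube (m + 1)) =
      ((0 : Fin (m + 1)).insertNth (xor b (z y)) y : Cube (m + 1)) := by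
  simp [rtStep]

theorem mean_prod {ι κ : Type*} [Fintype ι] [Fintype κ] (f : ι × κ → ℝ) :
    mean f = mean fun i => mean fun k => f (i, k) := by
  simp only [mean]
  rw [Fintype.sum_prod_type, ← Finset.sum_div, Fintype.card_prod, div_div, Nat.cast_mul, mul_comm]

section
variable {C : Type*}

/-- The two values of the tracked bit read disjoint families of coins, so the halves are shuffled
independently. -/
theorem thorpStep_comp_splitAt {m : ℕ} (p : Fin (m + 1))
    (Q : (Cube (m + 1) → C) × (Cube (m + 1) → C) → ℝ) :
    thorpStep (fun f => Q (splitAt C p.castSucc f)) =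
      fun f => onLeft thorpStep (onRight thorpStep Q) (splitAt C p.succ f) := by
  funext f
  simp only [thorpStep, onLeft, onRight]
  rw [← mean_prod fun z : (Cube m → Bool) × (Cube m → Bool) =>
    Q ((splitAt C p.succ f).1 ∘ rtStep z.1, (splitAt C p.succ f).2 ∘ rtStep z.2),
    ← mean_comp_equiv (splitAt Bool p)]
  congr 1
  funext z
  congr 1
  refine Prod.ext ?_ ?_ <;> funext y <;>
    simp only [splitAt, Equiv.coe_fn_mk, Function.comp_apply, rtStep_insertNth]

theorem thorpStep_comp_splitAt_last {m : ℕ} (Q : (Cube m → C) × (Cube m → C) → ℝ) :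
    thorpStep (fun f => Q (splitAt C (Fin.last m) f)) =
      fun f => coinSwap Q (splitAt C 0 f) := by
  funext f
  simp only [thorpStep, coinSwap]
  congr 1
  funext z
  congr 1
  refine Prod.ext ?_ ?_ <;> funext y <;>
    simp only [splitAt, Equiv.coe_fn_mk, Function.comp_apply, rtStep_insertNth_last, swapOn] <;>
    cases z y <;> rfl

theorem iterate_onLeft {X Y : Type*} (T : (X → ℝ) → X → ℝ) (k : ℕ) (p : X × Y → ℝ) :
    (onLeft T)^[k] p = onLeft T^[k] p := by
  induction k with
  | zero => rfl
  | succ k ih => rw [Function.iterate_succ_apply', ih, Function.iterate_succ']; rfl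

theorem iterate_onRight {X Y : Type*} (T : (Y → ℝ) → Y → ℝ) (k : ℕ) (p : X × Y → ℝ) :
    (onRight T)^[k] p = onRight T^[k] p := by
  induction k with
  | zero => rfl
  | succ k ih => rw [Function.iterate_succ_apply', ih, Function.iterate_succ']; rfl

theorem mean_comm {ι κ : Type*} [Fintype ι] [Fintype κ] (f : ι → κ → ℝ) :
    (mean fun i => mean fun k => f i k) = mean fun k => mean fun i => f i k := by
  simp only [mean, ← Finset.sum_div]
  rw [Finset.sum_comm, div_right_comm]

theorem commute_onLeft_onRight_thorpStep (m : ℕ) :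
    Function.Commute (onLeft thorpStep : ((Cube (m + 1) → C) × (Cube (m + 1) → C) → ℝ) → _)
      (onRight thorpStep) := by
  intro Q
  funext x
  exact mean_comm _

/-- `m + 1` rounds of the reverse Thorp shuffle act as the butterfly network. -/
theorem iterate_thorpStep (m : ℕ) (q : (Cube (m + 1) → C) → ℝ) :
    thorpStep^[m + 1] q = butterfly (m + 1) q := by
  induction m with
  | zero =>
    have h := thorpStep_comp_splitAt_last fun x => q ((halves 0 C).symm x)
    have h0 : splitAt C (Fin.last 0) = halves 0 C := splitAt_zero 0 C
    rw [h0] at h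
    simp only [Equiv.symm_apply_apply, splitAt_zero] at h
    exact h
  | succ m ih =>
    set Q : (Cube (m + 1) → C) × (Cube (m + 1) → C) → ℝ :=
      fun x => q ((halves (m + 1) C).symm x) with hQ
    have hq : q = fun f => Q (splitAt C 0 f) := by
      funext f; simp [hQ, splitAt_zero]
    -- After `k` rounds the bit that was first stands at place `k`.
    have hk : ∀ k (hk : k < m + 2), thorpStep^[k] q =
        fun f => (onLeft thorpStep ∘ onRight thorpStep)^[k] Q (splitAt C ⟨k, hk⟩ f) := by
      intro k
      induction k with
      | zero => intro _; exact hq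
      | succ k ihk =>
        intro hk
        rw [Function.iterate_succ_apply', ihk (by omega), Function.iterate_succ_apply']
        exact thorpStep_comp_splitAt ⟨k, by omega⟩ _
    rw [Function.iterate_succ_apply', hk (m + 1) (by omega)]
    refine (thorpStep_comp_splitAt_last _).trans ?_
    -- The half-shuffles commute, so all rounds on the right half can be grouped before those on the
    -- left.
    rw [(commute_onLeft_onRight_thorpStep m).comp_iterate, Function.comp_apply, iterate_onLeft,
      iterate_onRight, splitAt_zero]
    have hT : (thorpStep^[m + 1] : ((Cube (m + 1) → C) → ℝ) → _) = butterfly (m + 1) := funext ih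
    rw [hT]
    rfl

end

/-! ### From labellings to permutations. -/

theorem Function.Injective.sum_extend_zero {α β : Type*} [Fintype α] [Fintype β] {e : α → β}
    (he : Function.Injective e) (p : α → ℝ) (G : ℝ → ℝ) (hG : G 0 = 0) :
    ∑ b, G (Function.extend e p 0 b) = ∑ a, G (p a) := by
  refine (Fintype.sum_of_injective e he _ _ (fun b hb => ?_) fun a => ?_).symm
  · rw [Function.extend_apply' _ _ _ (by simpa using hb), Pi.zero_apply, hG]
  · rw [he.extend_apply]

/-- The action of one round of the reverse Thorp shuffle on laws of permutations. -/
noncomputable def permStep {m : ℕ} (p : Equiv.Perm (Cube (m + 1)) → ℝ)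
    (σ : Equiv.Perm (Cube (m + 1))) : ℝ :=
  mean fun z : Cube m → Bool => p ((rtStep z)⁻¹ * σ)

/-- The labelling of the positions by the cards that a permutation puts there. -/
def cardAt {m : ℕ} (σ : Equiv.Perm (Cube (m + 1))) : Cube (m + 1) → Cube (m + 1) := ⇑σ⁻¹

theorem cardAt_injective (m : ℕ) : Function.Injective (cardAt (m := m)) :=
  fun _ _ h => inv_injective (DFunLike.coe_injective h)

theorem cardAt_inv_mul {m : ℕ} (τ σ : Equiv.Perm (Cube (m + 1))) :
    cardAt (τ⁻¹ * σ) = cardAt σ ∘ τ := by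
  rw [cardAt, mul_inv_rev, inv_inv]; rfl

/-- Moving positions preserves bijectivity of a labelling, so no mass leaves or enters the image of
`cardAt`. -/
theorem thorpStep_extend {m : ℕ} (p : Equiv.Perm (Cube (m + 1)) → ℝ) :
    thorpStep (Function.extend cardAt p 0) = Function.extend cardAt (permStep p) 0 := by
  funext f
  by_cases h : ∃ σ, cardAt σ = f
  · obtain ⟨σ, rfl⟩ := h
    rw [(cardAt_injective m).extend_apply, thorpStep, permStep]
    congr 1
    funext z
    rw [← cardAt_inv_mul, (cardAt_injective m).extend_apply]
  · rw [Function.extend_apply' _ _ _ h, thorpStep]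
    have : ∀ z : Cube m → Bool, Function.extend cardAt p 0 (f ∘ rtStep z) = 0 := by
      intro z
      rw [Function.extend_apply', Pi.zero_apply]
      rintro ⟨σ, hσ⟩
      refine h ⟨rtStep z * σ, ?_⟩
      have h1 := cardAt_inv_mul (rtStep z)⁻¹ σ
      rw [inv_inv, hσ] at h1
      rw [h1]
      funext u
      simp
    simp [this, mean]

theorem iterate_thorpStep_extend {m : ℕ} (p : Equiv.Perm (Cube (m + 1)) → ℝ) (k : ℕ) :
    thorpStep^[k] (Function.extend cardAt p 0) =
      Function.extend cardAt (permStep^[k] p) 0 := by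
  induction k with
  | zero => rfl
  | succ k ih => rw [Function.iterate_succ_apply', ih, thorpStep_extend,
      Function.iterate_succ_apply']

theorem relEntropy_eq {V : Type*} [Fintype V] [Nonempty V] {p : V → ℝ} (hp : ∑ v, p v = 1) :
    relEntropy p = sumMulLog p + Real.log (Fintype.card V) := by
  have hc : (Fintype.card V : ℝ) ≠ 0 := by exact_mod_cast Fintype.card_ne_zero
  rw [relEntropy, sumMulLog, ← one_mul (Real.log (Fintype.card V)), ← hp, Finset.sum_mul,
    ← Finset.sum_add_distrib]
  refine Finset.sum_congr rfl fun v _ => ?_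
  by_cases h : p v = 0
  · simp [h]
  · rw [Real.log_mul hc h]; ring

/-- Entropy contraction for laws of permutations. -/
theorem relEntropy_iterate_permStep_le {m : ℕ} {p : Equiv.Perm (Cube (m + 1)) → ℝ}
    (hp0 : ∀ σ, 0 ≤ p σ) (hp1 : ∑ σ, p σ = 1) :
    relEntropy (permStep^[m + 1] p) ≤ (1 - 1 / 72 / ((m + 1 : ℕ) : ℝ)) * relEntropy p := by
  have hinj := cardAt_injective m
  set q := Function.extend cardAt p 0 with hq
  have hit : butterfly (m + 1) q = Function.extend cardAt (permStep^[m + 1] p) 0 := by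
    rw [← iterate_thorpStep, iterate_thorpStep_extend]
  have hsum : ∀ p : Equiv.Perm (Cube (m + 1)) → ℝ,
      ∑ f, Function.extend cardAt p 0 f = ∑ σ, p σ := fun p =>
    hinj.sum_extend_zero p id rfl
  have hlogsum : ∀ p : Equiv.Perm (Cube (m + 1)) → ℝ,
      sumMulLog (Function.extend cardAt p 0) = sumMulLog p := fun p =>
    hinj.sum_extend_zero p (fun t => t * Real.log t) (by simp)
  have hm : (1 : ℝ) ≤ ((m + 1 : ℕ) : ℝ) := by push_cast; linarith [Nat.cast_nonneg (α := ℝ) m]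
  have hq0 : ∀ f, 0 ≤ q f := by
    intro f
    by_cases h : ∃ σ, cardAt σ = f
    · obtain ⟨σ, rfl⟩ := h
      rw [hq, hinj.extend_apply]; exact hp0 σ
    · rw [hq, Function.extend_apply' _ _ _ h, Pi.zero_apply]
  have hqA : InjectiveOn Finset.univ q := by
    intro f hf
    by_cases h : ∃ σ, cardAt σ = f
    · obtain ⟨σ, rfl⟩ := h
      exact ⟨(σ⁻¹).injective, fun u => Finset.mem_univ _⟩
    · rw [hq, Function.extend_apply' _ _ _ h, Pi.zero_apply] at hf
      exact absurd rfl hf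
  have hcard : Fintype.card (Equiv.Perm (Cube (m + 1))) = (2 ^ (m + 1)).factorial := by
    rw [Fintype.card_perm]; simp [Cube]
  have hlog2 : Real.log (2 ^ (m + 1) : ℕ) ≤ ((m + 1 : ℕ) : ℝ) := by
    rw [Nat.cast_pow, Real.log_pow]
    have : Real.log (2 : ℕ) ≤ 1 := by
      have := Real.log_two_lt_d9
      push_cast; linarith
    nlinarith
  -- Here `L = d`, allowed since `log 2 ≤ 1`; this gives `c = 1 / 72`.
  have hdrop := butterfly_entropy_drop (show (1 : ℝ) / 2 ≤ ((m + 1 : ℕ) : ℝ) by linarith) (m + 1)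
    hlog2 (Finset.univ : Finset (Cube (m + 1))) (by simp [Cube]) q hq0 hqA
  have hmass : ∑ σ, permStep^[m + 1] p σ = 1 := by
    rw [← hsum, ← hit, sum_butterfly, hq, hsum, hp1]
  have hlhs : ∑ f, q f * (Real.log (q f) + Real.log (2 ^ (m + 1)).factorial -
      Real.log (∑ f, q f)) = relEntropy p := by
    have h1 : ∑ f, q f = 1 := by rw [hq, hsum, hp1]
    rw [relEntropy_eq hp1, h1, Real.log_one, hcard, ← hlogsum, ← hq, sumMulLog]
    simp only [sub_zero, mul_add, Finset.sum_add_distrib, ← Finset.sum_mul, h1, one_mul]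
  rw [hlhs, hit, hlogsum, hlogsum] at hdrop
  have e1 := relEntropy_eq hp1
  have e2 := relEntropy_eq hmass
  have e3 : 1 / (72 * ((m + 1 : ℕ) : ℝ)) = 1 / 72 / ((m + 1 : ℕ) : ℝ) := by rw [div_div]
  rw [e3] at hdrop
  rw [sub_mul, one_mul]
  linarith

/-! ### The law of the random shuffle. -/

section
variable {Ω : Type*} [MeasurableSpace Ω] {P : Measure Ω} [IsProbabilityMeasure P]

/-- The law of a product of independent random permutations. -/
theorem measureReal_mul_eq {V α : Type} [Fintype V] [MeasurableSpace V]
    [MeasurableSingletonClass V] {Y : Ω → V} {X : Ω → Equiv.Perm α}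
    (hY : Measurable Y) (hX : Measurable X) (h : IndepFun Y X P) (a : V → Equiv.Perm α)
    (σ : Equiv.Perm α) :
    P.real ((fun ω => a (Y ω) * X ω) ⁻¹' {σ}) =
      ∑ y, P.real (Y ⁻¹' {y}) * P.real (X ⁻¹' {(a y)⁻¹ * σ}) := by
  have hs : (fun ω => a (Y ω) * X ω) ⁻¹' {σ} =
      ⋃ y ∈ (Finset.univ : Finset V), Y ⁻¹' {y} ∩ X ⁻¹' {(a y)⁻¹ * σ} := by
    ext ω
    simp [eq_inv_mul_iff_mul_eq]
  have hXm : ∀ τ : Equiv.Perm α, MeasurableSet (X ⁻¹' {τ}) := fun τ => hX trivial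
  rw [hs, measureReal_biUnion_finset]
  · refine Finset.sum_congr rfl fun y _ => ?_
    rw [measureReal_def, h.measure_inter_preimage_eq_mul _ _ (measurableSet_singleton y) trivial,
      ENNReal.toReal_mul]
    rfl
  · intro y _ y' _ hne
    refine Set.disjoint_left.2 fun ω h1 h2 => hne ?_
    exact (show Y ω = y from h1.1).symm.trans h2.1
  · exact fun y _ => (hY (measurableSet_singleton y)).inter (hXm _)

variable {m : ℕ} {Z : ℕ → Cube m → Ω → Bool}

theorem IsFairCoins.measureReal_round (hZ : IsFairCoins P Z) (t : ℕ)
    (z : Cube m → Bool) :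
    P.real ((fun ω l => Z t l ω) ⁻¹' {z}) = (Fintype.card (Cube m → Bool) : ℝ)⁻¹ := by
  have hone : ∀ l b, P (Z t l ⁻¹' {b}) = 1 / 2 := by
    intro l b
    cases b
    · have hc : Z t l ⁻¹' {false} = (Z t l ⁻¹' {true})ᶜ := by
        ext ω; simp
      rw [hc, prob_compl_eq_one_sub (hZ.measurable t l (measurableSet_singleton _)), hZ.fair]
      simp
    · exact hZ.fair t l
  have hs : (fun ω l => Z t l ω) ⁻¹' {z} =
      ⋂ i ∈ ({t} : Finset ℕ) ×ˢ (Finset.univ : Finset (Cube m)), (fun ω => Z i.1 i.2 ω) ⁻¹' {z i.2} := by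
    ext ω
    simp [funext_iff]
  rw [hs, measureReal_def, hZ.indep.measure_inter_preimage_eq_mul _
    fun i _ => measurableSet_singleton _, Finset.prod_product]
  simp [hone]

theorem reverseThorp_congr {z z' : ℕ → Cube m → Bool} {t : ℕ}
    (h : ∀ s < t, ∀ l, z s l = z' s l) : reverseThorp z t = reverseThorp z' t := by
  induction t with
  | zero => rfl
  | succ t ih =>
    have h1 : z t = z' t := funext fun l => h t (Nat.lt_succ_self t) l
    rw [reverseThorp, reverseThorp, h1, ih fun s hs l => h s (Nat.lt_succ_of_lt hs) l]

omit [IsProbabilityMeasure P] in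
/-- The shuffle at time `t` is measurable, and independent of the coins of time `t`. -/
theorem IsFairCoins.indepFun_round (hZ : IsFairCoins P Z) (t : ℕ) :
    Measurable (fun ω => reverseThorpProcess Z ω t) ∧
      IndepFun (fun ω l => Z t l ω) (fun ω => reverseThorpProcess Z ω t) P := by
  set T : Finset (ℕ × Cube m) := Finset.range t ×ˢ Finset.univ with hT
  set S : Finset (ℕ × Cube m) := {t} ×ˢ Finset.univ with hS
  have hdisj : Disjoint S T := by
    rw [Finset.disjoint_left]
    rintro ⟨s, l⟩ h1 h2
    simp only [hS, hT, Finset.mem_product, Finset.mem_singleton, Finset.mem_range,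
      Finset.mem_univ, and_true] at h1 h2
    omega
  have hmeas : ∀ i : ℕ × Cube m, Measurable (fun ω => Z i.1 i.2 ω) := fun i =>
    hZ.measurable i.1 i.2
  -- The default `false` is never read: the shuffle at time `t` uses only the coins of earlier
  -- times.
  set F : (T → Bool) → Equiv.Perm (Cube (m + 1)) := fun w =>
    reverseThorp (fun s l => if h : (s, l) ∈ T then w ⟨(s, l), h⟩ else false) t with hF
  set G : (S → Bool) → Cube m → Bool := fun w l => w ⟨(t, l), by simp [hS]⟩ with hG
  have hFX : (fun ω => reverseThorpProcess Z ω t) =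
      F ∘ fun ω (i : T) => Z i.1.1 i.1.2 ω := by
    funext ω
    refine reverseThorp_congr fun s hs l => ?_
    have : (s, l) ∈ T := by simp [hT, hs]
    simp [this]
  have hGX : (fun ω l => Z t l ω) = G ∘ fun ω (i : S) => Z i.1.1 i.1.2 ω := rfl
  have hFm : Measurable F := Measurable.of_discrete
  have hGm : Measurable G := Measurable.of_discrete
  rw [hFX, hGX]
  exact ⟨hFm.comp (measurable_pi_lambda _ fun i => hmeas i.1),
    (hZ.indep.indepFun_finset S T hdisj hmeas).comp hGm hFm⟩

/-- The law of the shuffled deck after `t` rounds. -/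
theorem IsFairCoins.measureReal_reverseThorp_mul (hZ : IsFairCoins P Z)
    (p : Equiv.Perm (Cube (m + 1)) → ℝ) (t : ℕ) (σ : Equiv.Perm (Cube (m + 1))) :
    ∑ g, P.real ((fun ω => reverseThorpProcess Z ω t) ⁻¹' {g}) * p (g⁻¹ * σ) =
      permStep^[t] p σ := by
  induction t generalizing σ with
  | zero =>
    rw [Finset.sum_eq_single 1]
    · have : (fun ω => reverseThorpProcess Z ω 0) ⁻¹' {1} = Set.univ := by
        ext ω; simp [reverseThorpProcess, reverseThorp]
      rw [this]; simp
    · intro g _ hg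
      have : (fun ω => reverseThorpProcess Z ω 0) ⁻¹' {g} = ∅ := by
        ext ω; simp [reverseThorpProcess, reverseThorp, hg.symm]
      rw [this]; simp
    · simp
  | succ t ih =>
    obtain ⟨hm, hind⟩ := hZ.indepFun_round t
    have hYm : Measurable (fun ω l => Z t l ω) :=
      measurable_pi_lambda _ fun l => hZ.measurable t l
    have hlaw : ∀ g, P.real ((fun ω => reverseThorpProcess Z ω (t + 1)) ⁻¹' {g}) =
        mean fun z : Cube m → Bool =>
          P.real ((fun ω => reverseThorpProcess Z ω t) ⁻¹' {(rtStep z)⁻¹ * g}) := by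
      intro g
      have h := measureReal_mul_eq hYm hm hind rtStep g
      simp only [hZ.measureReal_round t] at h
      rw [mean, div_eq_inv_mul, Finset.mul_sum]
      exact h
    rw [Function.iterate_succ_apply', permStep]
    simp only [← ih, hlaw]
    rw [← sum_mean_comm]
    have h1 : ∀ z : Cube m → Bool, ∑ g, P.real ((fun ω => reverseThorpProcess Z ω t) ⁻¹'
        {g}) * p (g⁻¹ * ((rtStep z)⁻¹ * σ)) =
        ∑ g, P.real ((fun ω => reverseThorpProcess Z ω t) ⁻¹' {(rtStep z)⁻¹ * g}) *
          p (g⁻¹ * σ) := by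
      intro z
      rw [← Equiv.sum_comp (Equiv.mulLeft (rtStep z)⁻¹)]
      refine Finset.sum_congr rfl fun g _ => ?_
      simp [mul_assoc]
    rw [sum_mean_comm]
    simp only [h1]
    rw [← sum_mean_comm]
    refine Finset.sum_congr rfl fun g _ => ?_
    rw [mean, mean, ← Finset.sum_mul]
    ring

end

/-- The deck has `2 ^ d` cards with `d = m + 1 ≥ 1`. -/
theorem lemma4p1 :
    ∃ c : ℝ, 0 < c ∧
      ∀ (m : ℕ) (Ω : Type*) [MeasurableSpace Ω] (P : Measure Ω) [IsProbabilityMeasure P]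
        (Z : ℕ → Cube m → Ω → Bool) (μ : Ω → Equiv.Perm (Cube (m + 1))),
        IsFairCoins P Z →
        Measurable μ →
        IndepFun (reverseThorpProcess Z) μ P →
        ENT P (fun ω => reverseThorpProcess Z ω (m + 1) * μ ω) ≤
          (1 - c / ((m + 1 : ℕ) : ℝ)) * ENT P μ := by
  refine ⟨1 / 72, by norm_num, ?_⟩
  intro m Ω _ P _ Z μ hZ hμ hind
  have hX := (hZ.indepFun_round (m + 1)).1
  have hind' : IndepFun (fun ω => reverseThorpProcess Z ω (m + 1)) μ P :=
    hind.comp (measurable_pi_apply (m + 1)) measurable_id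
  have hlaw : (fun σ => P.real ((fun ω => reverseThorpProcess Z ω (m + 1) * μ ω) ⁻¹' {σ})) =
      permStep^[m + 1] fun σ => P.real (μ ⁻¹' {σ}) := by
    funext σ
    have : MeasurableSingletonClass (Equiv.Perm (Cube (m + 1))) := ⟨fun _ => trivial⟩
    rw [← hZ.measureReal_reverseThorp_mul]
    exact measureReal_mul_eq hX hμ hind' id σ
  rw [ENT, ENT, hlaw]
  refine relEntropy_iterate_permStep_le (fun σ => measureReal_nonneg) ?_
  rw [sum_measureReal_preimage_singleton _ fun σ _ => hμ trivial]
  simp
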